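/- Let $\ell>0$, $\ell\mathbb Z_+=\{\ell k:\ k=0,1,2,\dots\}$, $\mathbb C_+=\{z:\operatorname{Im}z>0\}$, $\mathbb D=\{z:|z|<1\}$. **Potentials and Schur functions.** Let $q$ be a complex Borel measure on $\mathbb R$ supported on $[0,\infty)$ and of finite total variation on every $[0,L]$. Put $$J=\begin{pmatrix}0&-1\\1&0\end{pmatrix},\qquad Q=\begin{pmatrix}\operatorname{Im}q&\operatorname{Re}q\\ \operatorname{Re}q&-\operatorname{Im}q\end{pmatrix},\qquad \mathbf g(T)=I+\sum_{n\ge2}\frac{T^{n-1}}{n!}.$$ Let $N(\cdot,z)=(n_{ij}(\cdot,z))$ be the unique right-continuous, locally bounded $2\times2$ matrix function on $\mathbb R$ solving $JN'+QN=zN$, $N(0-,z)=I$, in the sense that for all $x\in\mathbb R$ $$JN(x,z)+\int_{(-\infty,x]}\mathbf g(Q(\{t\})J^*)\,dQ(t)\,N(t,z)-z\int_{[0,x]}N(t,z)\,dt=J,$$ where the last integral is $0$ for $x<0$. The Weyl function of the Dirac operator $\mathcal D_q$ is $m_q(z)=\lim_{x\to+\infty}n_{22}(x,z)/n_{21}(x,z)$,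 $z\in\mathbb C_+$, and its Schur function $f_q$ is determined by $m_q=i\frac{1+f_q}{1-f_q}$. **The class $S_{\ell,*}(\mathbb C_+)$.** Let $S_*(\mathbb D)$ be the set of analytic $F$ on $\mathbb D$ with $|F|\le1$ that are not finite Blaschke products (unimodular constants count as finite Blaschke products). Let $S_{\ell,*}(\mathbb C_+)$ be the set of functions $f:\mathbb C_+\to\mathbb D$ of the form $f(z)=F(e^{2i\ell z})$ with $F\in S_*(\mathbb D)$. For $f\in S_{\ell,*}(\mathbb C_+)$ the recurrence coefficients $f_k(\infty)$, $k\ge0$, are defined by $$f_0=f,\qquad e^{2i\ell z}f_{k+1}=\frac{f_k-f_k(\infty)}{1-\overline{f_k(\infty)}f_k},\qquad f_k(\infty)=\lim_{y\to+\infty}f_k(iy).$$ Finally, let $\varkappa(w)=\frac{\overline w}{2|w|}\log\frac{1+|w|}{1-|w|}$ for $w\in\mathbb D\setminus\{0\}$ and $\varkappa(0)=0$. **Theorem.** Let $q$ be as above with $\operatorname{supp}q\subset\ell\mathbb Z_+$ (that is, $q=\sum_{k\ge0}c_k\delta_{\ell k}$ with arbitrary $c_k\in\mathbb C$). Then $N$,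 $m_q$ and $f_q$ are well defined on $\mathbb C_+$, and $f_q$ is $\pi/\ell$-periodic and belongs to $S_{\ell,*}(\mathbb C_+)$. Every element of $S_{\ell,*}(\mathbb C_+)$ is the Schur function $f_q$ of exactly one such $q$. Moreover, the recurrence coefficients $f_{q,k}(\infty)$ of $f_q$ exist and lie in $\mathbb D$, and $q$ and $f_q$ determine each other via $$q(\{\ell k\})=\varkappa(f_{q,k}(\infty)),\qquad k=0,1,2,\dots;$$ that is, this identity holds for all $k$, and for every such $q$ and every $f\in S_{\ell,*}(\mathbb C_+)$ one has $f=f_q$ if and only if $q(\{\ell k\})=\varkappa(f_k(\infty))$ for all $k\ge0$. -/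

import Mathlib

open MeasureTheory Filter Topology Set
open scoped UpperHalfPlane

noncomputable section

namespace DiracSchur

/-- A complex Borel measure `q` on `ℝ`, supported on `[0, ∞)` and of finite total variation on every
interval `[0, L]`. It is presented by the compatible family of its restrictions `upTo x` to the
half-lines `(-∞, x]`, each of which is a (finite) complex measure. -/
@[ext]
structure LocalComplexMeasure where
  upTo : ℝ → ComplexMeasure ℝ
  restrict_upTo : ∀ x y : ℝ, x ≤ y → (upTo y).restrict (Iic x) = upTo x
  upTo_of_neg : ∀ x : ℝ, x < 0 → upTo x = 0

/-- The point mass `q({x})`. -/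
def LocalComplexMeasure.atom (q : LocalComplexMeasure) (x : ℝ) : ℂ := q.upTo x {x}

/-- The half-lattice `ℓℤ₊ = {ℓ k : k = 0, 1, 2, …}`. -/
def halfLattice (ℓ : ℝ) : Set ℝ := Set.range fun k : ℕ => ℓ * (k : ℝ)

/-- `supp q ⊆ ℓℤ₊`, that is, `q` vanishes on every (bounded above) Borel set which does not meet
the closed set `ℓℤ₊`. -/
def LocalComplexMeasure.SupportedOnLattice (q : LocalComplexMeasure) (ℓ : ℝ) : Prop :=
  ∀ (x : ℝ) (A : Set ℝ), MeasurableSet A → Disjoint A (halfLattice ℓ) → q.upTo x A = 0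

/-- The matrix `J`. -/
def J : Matrix (Fin 2) (Fin 2) ℂ := !![0, -1; 1, 0]

/-- The matrix potential `Q = (Im q, Re q; Re q, -Im q)`, as a matrix of signed measures, restricted
to `(-∞, x]`. -/
def potential (q : LocalComplexMeasure) (x : ℝ) : Matrix (Fin 2) (Fin 2) (SignedMeasure ℝ) :=
  !![ComplexMeasure.im (q.upTo x), ComplexMeasure.re (q.upTo x);
     ComplexMeasure.re (q.upTo x), -ComplexMeasure.im (q.upTo x)]

/-- The point mass `Q({x})` of the matrix potential. -/
def potentialAtom (q : LocalComplexMeasure) (x : ℝ) : Matrix (Fin 2) (Fin 2) ℂ :=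
  !![((q.atom x).im : ℂ), ((q.atom x).re : ℂ); ((q.atom x).re : ℂ), -((q.atom x).im : ℂ)]

/-- The entire function `g(T) = I + ∑_{n ≥ 2} T^(n-1) / n!` of a `2 × 2` matrix. -/
def perssonG (T : Matrix (Fin 2) (Fin 2) ℂ) : Matrix (Fin 2) (Fin 2) ℂ :=
  1 + ∑' n : ℕ, (((n + 2).factorial : ℂ)⁻¹) • T ^ (n + 1)

/-- The matrix integral `∫_{(-∞, x]} g(Q({t}) J*) dQ(t) N(t)`, computed entrywise. -/
def potentialIntegral (q : LocalComplexMeasure) (N : ℝ → Matrix (Fin 2) (Fin 2) ℂ) (x : ℝ) :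
    Matrix (Fin 2) (Fin 2) ℂ :=
  Matrix.of fun i j => ∑ k, ∑ l,
    ∫ᵛ t, (perssonG (potentialAtom q t * J.conjTranspose) i k * N t l j) ∂<•(potential q x k l)

/-- `N` is the fundamental matrix solution of `J N' + Q N = z N`, `N(0-) = I`, in the sense of
Persson: it is continuous from the right, locally bounded, and for all real `x`
`J N(x) + ∫_{(-∞, x]} g(Q({t}) J*) dQ(t) N(t) - z ∫_{[0, x]} N(t) dt = J`.
The coefficient of the equation is the matrix measure `dQ - z 1_{[0, ∞)} dt`, whose point masses are
those of `Q`. -/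
structure IsFundamentalSolution (q : LocalComplexMeasure) (z : ℂ)
    (N : ℝ → Matrix (Fin 2) (Fin 2) ℂ) : Prop where
  rightContinuous : ∀ x : ℝ, ContinuousWithinAt N (Ici x) x
  locallyBounded : ∀ L : ℝ, ∃ C : ℝ, ∀ x ∈ Icc (-L) L, ∀ i j, ‖N x i j‖ ≤ C
  equation : ∀ x : ℝ,
    J * N x + potentialIntegral q N x - z • (Matrix.of fun i j => ∫ t in Icc 0 x, N t i j) = J

/-- The fundamental matrix solution `N(x, z)`. -/
def fundamentalSolution (q : LocalComplexMeasure) (z : ℂ) : ℝ → Matrix (Fin 2) (Fin 2) ℂ :=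
  Classical.epsilon (IsFundamentalSolution q z)

/-- The Weyl function `m_q(z) = lim_{x → ∞} n₂₂(x, z) / n₂₁(x, z)` of the Dirac operator. -/
def weylFunction (q : LocalComplexMeasure) (z : ℍ) : ℂ :=
  limUnder atTop fun x : ℝ => fundamentalSolution q z x 1 1 / fundamentalSolution q z x 1 0

/-- The Schur function `f_q = (m_q - i) / (m_q + i)` of the Dirac operator. -/
def schurFunction (q : LocalComplexMeasure) (z : ℍ) : ℂ :=
  (weylFunction q z - Complex.I) / (weylFunction q z + Complex.I)

/-- `F` is a finite Blaschke product in the unit disk (unimodular constants are included as the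
products of degree `0`). -/
def IsFiniteBlaschkeProduct (F : ℂ → ℂ) : Prop :=
  ∃ (c : ℂ) (n : ℕ) (a : Fin n → ℂ), ‖c‖ = 1 ∧ (∀ i, ‖a i‖ < 1) ∧
    ∀ z ∈ Metric.ball (0 : ℂ) 1,
      F z = c * ∏ i, (z - a i) / (1 - (starRingEnd ℂ) (a i) * z)

/-- The class `S_*(𝔻)`: analytic functions on the unit disk, bounded by `1`, that are not finite
Blaschke products. -/
def schurClassDisk : Set (ℂ → ℂ) :=
  {F | DifferentiableOn ℂ F (Metric.ball 0 1) ∧ (∀ z ∈ Metric.ball (0 : ℂ) 1, ‖F z‖ ≤ 1) ∧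
    ¬ IsFiniteBlaschkeProduct F}

/-- The class `S_{ℓ,*}(ℂ₊)`: functions `f : ℂ₊ → 𝔻` of the form `f(z) = F(e^{2iℓz})` with
`F ∈ S_*(𝔻)`. -/
def periodicSchurClass (ℓ : ℝ) : Set (ℍ → ℂ) :=
  {f | (∀ z : ℍ, ‖f z‖ < 1) ∧
    ∃ F ∈ schurClassDisk, ∀ z : ℍ, f z = F (Complex.exp (2 * Complex.I * (ℓ : ℂ) * (z : ℂ)))}

/-- The function `y ↦ f(iy)`; only `y > 0` matters. -/
def alongImaginaryAxis (f : ℍ → ℂ) (y : ℝ) : ℂ := f (UpperHalfPlane.ofComplex (Complex.I * (y : ℂ)))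

/-- `f(∞) = lim_{y → +∞} f(iy)`. -/
def valueAtInfinity (f : ℍ → ℂ) : ℂ := limUnder atTop (alongImaginaryAxis f)

/-- The iterates of Schur's algorithm in `ℂ₊`: `f₀ = f` and
`e^{2iℓz} f_{k+1} = (f_k - f_k(∞)) / (1 - conj(f_k(∞)) f_k)`. -/
def schurIterate (ℓ : ℝ) (f : ℍ → ℂ) : ℕ → ℍ → ℂ
  | 0 => f
  | k + 1 => fun z =>
      ((schurIterate ℓ f k z - valueAtInfinity (schurIterate ℓ f k)) /
        (1 - (starRingEnd ℂ) (valueAtInfinity (schurIterate ℓ f k)) * schurIterate ℓ f k z)) /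
      Complex.exp (2 * Complex.I * (ℓ : ℂ) * (z : ℂ))

/-- The recurrence coefficients `f_k(∞)` of `f`. -/
def recurrenceCoeff (ℓ : ℝ) (f : ℍ → ℂ) (k : ℕ) : ℂ := valueAtInfinity (schurIterate ℓ f k)

/-- `ϰ(w) = (conj w / (2|w|)) log((1 + |w|) / (1 - |w|))`, with `ϰ(0) = 0`. -/
def kappa (w : ℂ) : ℂ :=
  (starRingEnd ℂ) w / (2 * (‖w‖ : ℂ)) * (Real.log ((1 + ‖w‖) / (1 - ‖w‖)) : ℂ)

end DiracSchur

end

/-! The Cayley ratio (r₁ - i r₀)/(r₁ + i r₀) of a row r turns right multiplication by the building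
blocks of N into maps of the disk. A free stretch is a rotation by θ and acts as multiplication by
e^{2iθ}. An atom c contributes exp(QJ*) and acts as the automorphism `mob w` with w = (conj c / |c|)
tanh |c|. For the second row of N(x, z), whose ratio is the Cayley transform of n₂₂/n₂₁, this yields
the finite continued fraction mob w₀ (ζ mob w₁ (ζ ⋯ mob wₙ τ)) with ζ = e^{2iℓz} and a tail τ in the
closed disk that depends on x (`vecMul_jumpMatrix`, `vecMul_rotation`, `vecMul_latticeState`).

Automorphisms preserve the pseudo-hyperbolic distance, and each factor ζ contracts it by at least
2|ζ|/(1 + |ζ|²) < 1. The tail is therefore forgotten exponentially fast, whatever the wₖ in the disk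
(`norm_schurApprox_sub_le`). Hence the Weyl limit exists for arbitrary atoms, and f_q(z) = F(ζ),
where F has Schur parameters wₖ. By the same estimate, a function on which Schur's algorithm never
stops is recovered from its parameters (`IsSchurChain.eq_schurLimit`).

The algorithm never stops exactly when F is not a finite Blaschke product, since a Schur step
changes the degree by one (`IsBlaschkeQuotient.mob_mul`, `IsBlaschkeQuotient.of_mob_mul`). Finally,
ζ → 0 as z → i∞, so fₖ(∞) = wₖ, and ϰ inverts c ↦ w. -/

namespace DiracSchur

open scoped ComplexConjugate

/-! ### Disk automorphisms and the pseudo-hyperbolic distance -/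

/-- The automorphism `a ↦ (a + w) / (1 + conj w * a)` of the unit disk. -/
noncomputable def mob (w a : ℂ) : ℂ := (a + w) / (1 + conj w * a)

lemma norm_lt_one_of_mul {ζ a : ℂ} (hζ : ‖ζ‖ < 1) (ha : ‖a‖ ≤ 1) : ‖ζ * a‖ < 1 := by
  rw [norm_mul]
  nlinarith [norm_nonneg ζ, norm_nonneg a]

lemma one_add_conj_mul_ne_zero {w a : ℂ} (hw : ‖w‖ < 1) (ha : ‖a‖ ≤ 1) : 1 + conj w * a ≠ 0 := by
  intro h
  have h1 : ‖conj w * a‖ < 1 := norm_lt_one_of_mul (by simpa using hw) ha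
  rw [show conj w * a = -1 by linear_combination h] at h1
  simp at h1

lemma mob_sub_mob {w a b : ℂ} (hw : ‖w‖ < 1) (ha : ‖a‖ ≤ 1) (hb : ‖b‖ ≤ 1) :
    mob w a - mob w b =
      (1 - conj w * w) * (a - b) / ((1 + conj w * a) * (1 + conj w * b)) := by
  have h1 := one_add_conj_mul_ne_zero hw ha
  have h2 := one_add_conj_mul_ne_zero hw hb
  unfold mob
  rw [div_sub_div _ _ h1 h2]
  congr 1
  ring

/-- Compared with `mob_sub_mob`, the same factor appears up to a unimodular number, so the quotient
|a - b| / |1 - conj a * b| is invariant. -/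
lemma one_sub_conj_mob_mul_mob {w a b : ℂ} (hw : ‖w‖ < 1) (ha : ‖a‖ ≤ 1) (hb : ‖b‖ ≤ 1) :
    1 - conj (mob w a) * mob w b =
      (1 - conj w * w) * (1 - conj a * b) / (conj (1 + conj w * a) * (1 + conj w * b)) := by
  have h1 := one_add_conj_mul_ne_zero hw ha
  have h2 := one_add_conj_mul_ne_zero hw hb
  have h3 : conj (1 + conj w * a) ≠ 0 := by simpa only [ne_eq, map_eq_zero] using h1
  unfold mob
  rw [map_div₀, div_mul_div_comm, eq_div_iff (mul_ne_zero h3 h2), sub_mul,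
    div_mul_cancel₀ _ (mul_ne_zero h3 h2)]
  simp only [map_add, map_mul, map_one, Complex.conj_conj]
  ring

lemma one_sub_normSq_mob {w a : ℂ} (hw : ‖w‖ < 1) (ha : ‖a‖ ≤ 1) :
    1 - ‖mob w a‖ ^ 2 = (1 - ‖w‖ ^ 2) * (1 - ‖a‖ ^ 2) / ‖1 + conj w * a‖ ^ 2 := by
  have h := one_sub_conj_mob_mul_mob hw ha ha
  simp only [Complex.conj_mul'] at h
  exact_mod_cast h

lemma norm_mob_le_one {w a : ℂ} (hw : ‖w‖ < 1) (ha : ‖a‖ ≤ 1) : ‖mob w a‖ ≤ 1 := by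
  have h := one_sub_normSq_mob hw ha
  have h1 : 0 ≤ 1 - ‖w‖ ^ 2 := by nlinarith [norm_nonneg w]
  have h2 : 0 ≤ 1 - ‖a‖ ^ 2 := by nlinarith [norm_nonneg a]
  have h3 : 0 ≤ 1 - ‖mob w a‖ ^ 2 := by rw [h]; positivity
  nlinarith [norm_nonneg (mob w a)]

lemma norm_mob_lt_one {w a : ℂ} (hw : ‖w‖ < 1) (ha : ‖a‖ < 1) : ‖mob w a‖ < 1 := by
  have h := one_sub_normSq_mob hw ha.le
  have h1 : 0 < 1 - ‖w‖ ^ 2 := by nlinarith [norm_nonneg w]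
  have h2 : 0 < 1 - ‖a‖ ^ 2 := by nlinarith [norm_nonneg a]
  have h4 : 0 < ‖1 + conj w * a‖ := norm_pos_iff.2 (one_add_conj_mul_ne_zero hw ha.le)
  have h3 : 0 < 1 - ‖mob w a‖ ^ 2 := by rw [h]; positivity
  nlinarith [norm_nonneg (mob w a)]

lemma mob_zero (w : ℂ) : mob w 0 = w := by simp [mob]

lemma sub_mob_div {w a : ℂ} (hw : ‖w‖ < 1) (ha : ‖a‖ ≤ 1) :
    (mob w a - w) / (1 - conj w * mob w a) = a := by
  have h1 := one_add_conj_mul_ne_zero hw ha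
  have h2 : 1 - conj w * w ≠ 0 := by
    rw [sub_eq_add_neg, ← mul_neg]
    exact one_add_conj_mul_ne_zero hw (by simpa using hw.le)
  have e1 : mob w a - w = (1 - conj w * w) * a / (1 + conj w * a) := by
    rw [mob, eq_div_iff h1, sub_mul, div_mul_cancel₀ _ h1]
    ring
  have e2 : 1 - conj w * mob w a = (1 - conj w * w) / (1 + conj w * a) := by
    unfold mob
    field_simp
    ring
  rw [e1, e2]
  field_simp

lemma mob_sub_div {w a : ℂ} (hw : ‖w‖ < 1) (ha : ‖a‖ ≤ 1) :
    mob w ((a - w) / (1 - conj w * a)) = a := by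
  have h1 : 1 - conj w * a ≠ 0 := by
    rw [sub_eq_add_neg, ← mul_neg]
    exact one_add_conj_mul_ne_zero hw (by simpa using ha)
  have h2 : 1 - conj w * w ≠ 0 := by
    rw [sub_eq_add_neg, ← mul_neg]
    exact one_add_conj_mul_ne_zero hw (by simpa using hw.le)
  have e1 : (a - w) / (1 - conj w * a) + w = (1 - conj w * w) * a / (1 - conj w * a) := by
    rw [eq_div_iff h1, add_mul, div_mul_cancel₀ _ h1]
    ring
  have e2 : 1 + conj w * ((a - w) / (1 - conj w * a)) =
      (1 - conj w * w) / (1 - conj w * a) := by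
    field_simp
    ring
  rw [mob, e1, e2]
  field_simp

lemma norm_sub_div_lt_one {w a : ℂ} (hw : ‖w‖ < 1) (ha : ‖a‖ < 1) :
    ‖(a - w) / (1 - conj w * a)‖ < 1 := by
  have h := norm_mob_lt_one (w := -w) (by simpa using hw) ha
  simpa [mob, sub_eq_add_neg] using h

/-- Disk automorphisms preserve the pseudo-hyperbolic distance. -/
lemma norm_mob_sub_mob_le {w a b : ℂ} (hw : ‖w‖ < 1) (ha : ‖a‖ ≤ 1) (hb : ‖b‖ ≤ 1) {D : ℝ}
    (h : ‖a - b‖ ≤ D * ‖1 - conj a * b‖) :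
    ‖mob w a - mob w b‖ ≤ D * ‖1 - conj (mob w a) * mob w b‖ := by
  rw [mob_sub_mob hw ha hb, one_sub_conj_mob_mul_mob hw ha hb]
  simp only [norm_div, norm_mul, Complex.norm_conj]
  calc ‖1 - conj w * w‖ * ‖a - b‖ / (‖1 + conj w * a‖ * ‖1 + conj w * b‖)
      ≤ ‖1 - conj w * w‖ * (D * ‖1 - conj a * b‖) / (‖1 + conj w * a‖ * ‖1 + conj w * b‖) := by
        gcongr
    _ = _ := by ring

/-- The factor by which multiplication by a number of modulus `r` contracts the pseudo-hyperbolic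
distance of the unit disk. -/
noncomputable def contractionRate (r : ℝ) : ℝ := 2 * r / (1 + r ^ 2)

lemma contractionRate_nonneg {r : ℝ} (h : 0 ≤ r) : 0 ≤ contractionRate r := by
  unfold contractionRate; positivity

lemma contractionRate_lt_one {r : ℝ} (h : r < 1) : contractionRate r < 1 := by
  rw [contractionRate, div_lt_one (by positivity)]
  nlinarith

lemma contractionRate_mono {r s : ℝ} (hr : 0 ≤ r) (hrs : r ≤ s) (hs : s ≤ 1) :
    contractionRate r ≤ contractionRate s := by
  rw [contractionRate, contractionRate, div_le_div_iff₀ (by positivity) (by positivity)]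
  have h : 0 ≤ (s - r) * (1 - r * s) :=
    mul_nonneg (by linarith) (by nlinarith)
  nlinarith

/-- The estimate behind `contractionRate`, used with u = conj a * b. Equality holds at u = -1. -/
lemma norm_one_sub_le {r : ℝ} (hr : 0 ≤ r) (hr1 : r ≤ 1) {u : ℂ} (hu : ‖u‖ ≤ 1) :
    (1 + r ^ 2) * ‖1 - u‖ ≤ 2 * ‖1 - (r : ℂ) ^ 2 * u‖ := by
  have hs : u.re ^ 2 + u.im ^ 2 ≤ 1 := by
    have h := Complex.sq_norm u
    rw [Complex.normSq_apply] at h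
    nlinarith [norm_nonneg u]
  have hx : -1 ≤ u.re := by nlinarith [sq_nonneg u.im]
  refine le_of_sq_le_sq ?_ (by positivity)
  rw [mul_pow, mul_pow, Complex.sq_norm, Complex.sq_norm, Complex.normSq_apply,
    Complex.normSq_apply]
  have e : (1 - (r : ℂ) ^ 2 * u).re = 1 - r ^ 2 * u.re ∧
      (1 - (r : ℂ) ^ 2 * u).im = - (r ^ 2 * u.im) := by
    rw [← Complex.ofReal_pow]
    constructor
    · rw [Complex.sub_re, Complex.one_re, Complex.re_ofReal_mul]
    · rw [Complex.sub_im, Complex.one_im, Complex.im_ofReal_mul, zero_sub]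
  rw [e.1, e.2]
  simp only [Complex.sub_re, Complex.one_re, Complex.sub_im, Complex.one_im]
  have hr2 : 0 ≤ 1 - r ^ 2 := by nlinarith
  -- This is 4|1 - r²u|² - (1 + r²)²|1 - u|² in factored form.
  have key : 0 ≤ (1 - r ^ 2) *
      (3 + r ^ 2 + 2 * u.re * (1 - r ^ 2) - (u.re ^ 2 + u.im ^ 2) * (1 + 3 * r ^ 2)) := by
    refine mul_nonneg hr2 ?_
    nlinarith [mul_nonneg (by linarith : 0 ≤ 1 + u.re) hr2,
      mul_nonneg (by linarith : 0 ≤ 1 - (u.re ^ 2 + u.im ^ 2))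
        (by positivity : 0 ≤ 1 + 3 * r ^ 2)]
  nlinarith [key]

/-- Bounding the distance in product form keeps points of the unit circle admissible, where the
quotient can be 0/0. -/
lemma norm_mul_sub_mul_le {ζ a b : ℂ} (hζ : ‖ζ‖ ≤ 1) (ha : ‖a‖ ≤ 1) (hb : ‖b‖ ≤ 1) {D : ℝ}
    (hD : 0 ≤ D) (h : ‖a - b‖ ≤ D * ‖1 - conj a * b‖) :
    ‖ζ * a - ζ * b‖ ≤ contractionRate ‖ζ‖ * D * ‖1 - conj (ζ * a) * (ζ * b)‖ := by
  have hu : ‖conj a * b‖ ≤ 1 := by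
    rw [norm_mul, Complex.norm_conj]
    exact mul_le_one₀ ha (norm_nonneg b) hb
  have h1 := norm_one_sub_le (norm_nonneg ζ) hζ hu
  have e : conj (ζ * a) * (ζ * b) = (‖ζ‖ : ℂ) ^ 2 * (conj a * b) := by
    rw [← Complex.conj_mul', map_mul]
    ring
  rw [e, ← mul_sub, norm_mul, contractionRate, div_mul_eq_mul_div, div_mul_eq_mul_div,
    le_div_iff₀ (by positivity)]
  calc ‖ζ‖ * ‖a - b‖ * (1 + ‖ζ‖ ^ 2)
      ≤ ‖ζ‖ * (D * ‖1 - conj a * b‖) * (1 + ‖ζ‖ ^ 2) := by gcongr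
    _ = ‖ζ‖ * D * ((1 + ‖ζ‖ ^ 2) * ‖1 - conj a * b‖) := by ring
    _ ≤ ‖ζ‖ * D * (2 * ‖1 - (‖ζ‖ : ℂ) ^ 2 * (conj a * b)‖) := by gcongr
    _ = _ := by ring

/-- The difference of the squares is (1 - |a|²)(1 - |b|²). -/
lemma norm_sub_le_norm_one_sub {a b : ℂ} (ha : ‖a‖ ≤ 1) (hb : ‖b‖ ≤ 1) :
    ‖a - b‖ ≤ 1 * ‖1 - conj a * b‖ := by
  rw [one_mul]
  refine le_of_sq_le_sq ?_ (by positivity)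
  have h1 : a.re ^ 2 + a.im ^ 2 ≤ 1 := by
    have h := Complex.sq_norm a
    rw [Complex.normSq_apply] at h
    nlinarith [norm_nonneg a]
  have h2 : b.re ^ 2 + b.im ^ 2 ≤ 1 := by
    have h := Complex.sq_norm b
    rw [Complex.normSq_apply] at h
    nlinarith [norm_nonneg b]
  rw [Complex.sq_norm, Complex.sq_norm, Complex.normSq_apply, Complex.normSq_apply]
  simp
  nlinarith [mul_nonneg (by linarith : 0 ≤ 1 - (a.re ^ 2 + a.im ^ 2))
    (by linarith : 0 ≤ 1 - (b.re ^ 2 + b.im ^ 2))]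

/-! ### Convergence of Schur continued fractions -/

/-- The finite Schur continued fraction with parameters `w 0, …, w n` and tail `τ`. -/
noncomputable def schurApprox (w : ℕ → ℂ) (ζ : ℂ) : ℕ → ℂ → ℂ
  | 0, τ => mob (w 0) τ
  | n + 1, τ => schurApprox w ζ n (ζ * mob (w (n + 1)) τ)

section Approx

variable {w : ℕ → ℂ} {ζ : ℂ}

/-- The definition adds parameters at the innermost place; here the outermost one is peeled off, as
in a step of Schur's algorithm. -/
lemma schurApprox_succ_eq (w : ℕ → ℂ) (ζ : ℂ) (n : ℕ) (τ : ℂ) :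
    schurApprox w ζ (n + 1) τ = mob (w 0) (ζ * schurApprox (fun k => w (k + 1)) ζ n τ) := by
  induction n generalizing τ with
  | zero => rfl
  | succ n ih =>
    rw [schurApprox, ih]
    rfl

lemma norm_schurApprox_le_one (hw : ∀ k, ‖w k‖ < 1) (hζ : ‖ζ‖ < 1) (n : ℕ) {τ : ℂ}
    (hτ : ‖τ‖ ≤ 1) : ‖schurApprox w ζ n τ‖ ≤ 1 := by
  induction n generalizing τ with
  | zero => exact norm_mob_le_one (hw 0) hτ
  | succ n ih => exact ih (norm_lt_one_of_mul hζ (norm_mob_le_one (hw _) hτ)).le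

lemma norm_schurApprox_sub_le_mul (hw : ∀ k, ‖w k‖ < 1) (hζ : ‖ζ‖ < 1) (n : ℕ) {a b : ℂ}
    (ha : ‖a‖ ≤ 1) (hb : ‖b‖ ≤ 1) {D : ℝ} (hD : 0 ≤ D) (h : ‖a - b‖ ≤ D * ‖1 - conj a * b‖) :
    ‖schurApprox w ζ n a - schurApprox w ζ n b‖ ≤ contractionRate ‖ζ‖ ^ n * D *
      ‖1 - conj (schurApprox w ζ n a) * schurApprox w ζ n b‖ := by
  induction n generalizing a b D with
  | zero => simpa [schurApprox] using norm_mob_sub_mob_le (hw 0) ha hb h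
  | succ n ih =>
    have ha' := norm_mob_le_one (hw (n + 1)) ha
    have hb' := norm_mob_le_one (hw (n + 1)) hb
    rw [pow_succ, mul_assoc (_ ^ n)]
    exact ih (norm_lt_one_of_mul hζ ha').le (norm_lt_one_of_mul hζ hb').le
      (mul_nonneg (contractionRate_nonneg (norm_nonneg ζ)) hD)
      (norm_mul_sub_mul_le hζ.le ha' hb' hD (norm_mob_sub_mob_le (hw _) ha hb h))

/-- The dependence of the Schur continued fraction on its tail is exponentially small. -/
lemma norm_schurApprox_sub_le (hw : ∀ k, ‖w k‖ < 1) (hζ : ‖ζ‖ < 1) (n : ℕ) {a b : ℂ}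
    (ha : ‖a‖ ≤ 1) (hb : ‖b‖ ≤ 1) :
    ‖schurApprox w ζ n a - schurApprox w ζ n b‖ ≤ 2 * contractionRate ‖ζ‖ ^ n := by
  have h := norm_schurApprox_sub_le_mul hw hζ n ha hb zero_le_one (norm_sub_le_norm_one_sub ha hb)
  have h1 : ‖1 - conj (schurApprox w ζ n a) * schurApprox w ζ n b‖ ≤ 2 := by
    refine (norm_sub_le _ _).trans ?_
    rw [norm_mul, Complex.norm_conj, norm_one]
    have := mul_le_one₀ (norm_schurApprox_le_one hw hζ n ha) (norm_nonneg _)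
      (norm_schurApprox_le_one hw hζ n hb)
    linarith
  have h2 : 0 ≤ contractionRate ‖ζ‖ ^ n := pow_nonneg (contractionRate_nonneg (norm_nonneg ζ)) n
  nlinarith

/-- Parameters beyond n only change the tail of the n-th approximant, which makes the approximants a
Cauchy sequence. -/
lemma exists_tail_schurApprox (hw : ∀ k, ‖w k‖ < 1) (hζ : ‖ζ‖ < 1) (n k : ℕ) {τ : ℂ}
    (hτ : ‖τ‖ ≤ 1) : ∃ σ : ℂ, ‖σ‖ ≤ 1 ∧ schurApprox w ζ (n + k) τ = schurApprox w ζ n σ := by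
  induction k generalizing τ with
  | zero => exact ⟨τ, hτ, rfl⟩
  | succ k ih => exact ih (norm_lt_one_of_mul hζ (norm_mob_le_one (hw _) hτ)).le

lemma tendsto_two_mul_contractionRate_pow (hζ : ‖ζ‖ < 1) :
    Tendsto (fun n : ℕ => 2 * contractionRate ‖ζ‖ ^ n) atTop (𝓝 0) := by
  simpa using (tendsto_pow_atTop_nhds_zero_of_lt_one (contractionRate_nonneg (norm_nonneg ζ))
    (contractionRate_lt_one hζ)).const_mul 2

/-- The function of the unit disk with Schur parameters `w`. -/
noncomputable def schurLimit (w : ℕ → ℂ) (ζ : ℂ) : ℂ :=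
  limUnder atTop fun n => schurApprox w ζ n 0

lemma tendsto_schurApprox_zero (hw : ∀ k, ‖w k‖ < 1) (hζ : ‖ζ‖ < 1) :
    Tendsto (fun n => schurApprox w ζ n 0) atTop (𝓝 (schurLimit w ζ)) := by
  refine CauchySeq.tendsto_limUnder (cauchySeq_of_le_tendsto_0' _ (fun n m hnm => ?_)
    (tendsto_two_mul_contractionRate_pow hζ))
  obtain ⟨k, rfl⟩ := Nat.exists_eq_add_of_le hnm
  obtain ⟨σ, hσ, h⟩ := exists_tail_schurApprox hw hζ n k (τ := 0) (by simp)
  rw [h, dist_eq_norm]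
  exact norm_schurApprox_sub_le hw hζ n (by simp) hσ

lemma norm_schurApprox_sub_schurLimit_le (hw : ∀ k, ‖w k‖ < 1) (hζ : ‖ζ‖ < 1) (n : ℕ) {τ : ℂ}
    (hτ : ‖τ‖ ≤ 1) :
    ‖schurApprox w ζ n τ - schurLimit w ζ‖ ≤ 2 * contractionRate ‖ζ‖ ^ n := by
  refine le_of_tendsto ((tendsto_schurApprox_zero hw hζ).const_sub _).norm ?_
  filter_upwards [eventually_ge_atTop n] with m hm
  obtain ⟨k, rfl⟩ := Nat.exists_eq_add_of_le hm
  obtain ⟨σ, hσ, h⟩ := exists_tail_schurApprox hw hζ n k (τ := 0) (by simp)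
  rw [h]
  exact norm_schurApprox_sub_le hw hζ n hτ hσ

lemma schurLimit_eq_mob (hw : ∀ k, ‖w k‖ < 1) (hζ : ‖ζ‖ < 1) :
    schurLimit w ζ = mob (w 0) (ζ * schurLimit (fun k => w (k + 1)) ζ) := by
  have h1 := (tendsto_add_atTop_iff_nat 1).2 (tendsto_schurApprox_zero hw hζ)
  simp only [schurApprox_succ_eq] at h1
  have h2 := tendsto_schurApprox_zero (fun k => hw (k + 1)) hζ
  have h3 : ‖schurLimit (fun k => w (k + 1)) ζ‖ ≤ 1 :=
    le_of_tendsto h2.norm (.of_forall fun n =>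
      norm_schurApprox_le_one (fun k => hw (k + 1)) hζ n (by simp))
  refine tendsto_nhds_unique h1 ?_
  unfold mob
  exact ((h2.const_mul ζ).add_const _).div (((h2.const_mul ζ).const_mul _).const_add 1)
    (one_add_conj_mul_ne_zero (hw 0) (norm_lt_one_of_mul hζ h3).le)

/-- A limit only gives ≤ 1; strictness comes from the outermost factor ζ, with |ζ| < 1. -/
lemma norm_schurLimit_lt_one (hw : ∀ k, ‖w k‖ < 1) (hζ : ‖ζ‖ < 1) : ‖schurLimit w ζ‖ < 1 := by
  have h2 := tendsto_schurApprox_zero (fun k => hw (k + 1)) hζ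
  have h3 : ‖schurLimit (fun k => w (k + 1)) ζ‖ ≤ 1 :=
    le_of_tendsto h2.norm (.of_forall fun n =>
      norm_schurApprox_le_one (fun k => hw (k + 1)) hζ n (by simp))
  rw [schurLimit_eq_mob hw hζ]
  exact norm_mob_lt_one (hw 0) (norm_lt_one_of_mul hζ h3)

lemma differentiableOn_mob_mul {v : ℂ} (hv : ‖v‖ < 1) {g : ℂ → ℂ} {s : Set ℂ}
    (hs : s ⊆ Metric.ball 0 1) (hg : DifferentiableOn ℂ g s) (hg1 : ∀ ζ ∈ s, ‖g ζ‖ ≤ 1) :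
    DifferentiableOn ℂ (fun ζ => mob v (ζ * g ζ)) s := by
  unfold mob
  have h : DifferentiableOn ℂ (fun ζ => ζ * g ζ) s := differentiableOn_id.mul hg
  refine (h.add_const v).div ((h.const_mul _).const_add 1) fun ζ hζ => ?_
  exact one_add_conj_mul_ne_zero hv
    (norm_lt_one_of_mul (by simpa using hs hζ) (hg1 ζ hζ)).le

lemma differentiableOn_schurApprox (hw : ∀ k, ‖w k‖ < 1) (n : ℕ) :
    DifferentiableOn ℂ (fun ζ => schurApprox w ζ n 0) (Metric.ball 0 1) := by
  induction n generalizing w with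
  | zero => exact differentiableOn_const _
  | succ n ih =>
    simp only [schurApprox_succ_eq]
    refine differentiableOn_mob_mul (hw 0) subset_rfl (ih fun k => hw (k + 1)) fun ζ hζ => ?_
    exact norm_schurApprox_le_one (fun k => hw (k + 1)) (by simpa using hζ) n (by simp)

lemma differentiableOn_schurLimit (hw : ∀ k, ‖w k‖ < 1) :
    DifferentiableOn ℂ (schurLimit w) (Metric.ball 0 1) := by
  intro ζ hζ
  rw [mem_ball_zero_iff] at hζ
  obtain ⟨r, hr, hr1⟩ := exists_between hζ
  have hr0 : 0 ≤ r := (norm_nonneg ζ).trans hr.le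
  have hsub : Metric.ball (0 : ℂ) r ⊆ Metric.ball 0 1 := Metric.ball_subset_ball hr1.le
  -- The geometric rate is monotone in |ζ|, hence uniform on the smaller disk, and Weierstrass's
  -- theorem applies.
  have hu : TendstoUniformlyOn (fun n ζ => schurApprox w ζ n 0) (schurLimit w) atTop
      (Metric.ball 0 r) := by
    rw [Metric.tendstoUniformlyOn_iff]
    intro ε hε
    have ht : Tendsto (fun n : ℕ => 2 * contractionRate r ^ n) atTop (𝓝 0) := by
      simpa using (tendsto_pow_atTop_nhds_zero_of_lt_one (contractionRate_nonneg hr0)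
        (contractionRate_lt_one hr1)).const_mul 2
    filter_upwards [ht.eventually_lt_const hε] with n hn η hη
    rw [mem_ball_zero_iff] at hη
    rw [dist_comm, dist_eq_norm]
    refine ((norm_schurApprox_sub_schurLimit_le hw (hη.trans hr1) n (by simp)).trans ?_).trans_lt hn
    have := contractionRate_mono (norm_nonneg η) hη.le hr1.le
    have := contractionRate_nonneg (norm_nonneg η)
    gcongr
  have hd : DifferentiableOn ℂ (schurLimit w) (Metric.ball 0 r) :=
    hu.tendstoLocallyUniformlyOn.differentiableOn
      (.of_forall fun n => (differentiableOn_schurApprox hw n).mono hsub) Metric.isOpen_ball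
  exact ((hd ζ (by simpa using hr)).differentiableAt
    (Metric.isOpen_ball.mem_nhds (by simpa using hr))).differentiableWithinAt

end Approx

/-! ### Schur chains -/

/-- The sequence `F` of analytic self-maps of the unit disk is produced by Schur's algorithm from
`F 0`, with Schur parameters `w`. -/
structure IsSchurChain (w : ℕ → ℂ) (F : ℕ → ℂ → ℂ) : Prop where
  differentiableOn : ∀ k, DifferentiableOn ℂ (F k) (Metric.ball 0 1)
  norm_lt_one : ∀ k, ∀ ζ : ℂ, ‖ζ‖ < 1 → ‖F k ζ‖ < 1
  eq_mob : ∀ k, ∀ ζ : ℂ, ‖ζ‖ < 1 → F k ζ = mob (w k) (ζ * F (k + 1) ζ)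

namespace IsSchurChain

variable {w : ℕ → ℂ} {F : ℕ → ℂ → ℂ}

lemma apply_zero (h : IsSchurChain w F) (k : ℕ) : F k 0 = w k := by
  rw [h.eq_mob k 0 (by simp), zero_mul, mob_zero]

lemma norm_param_lt_one (h : IsSchurChain w F) (k : ℕ) : ‖w k‖ < 1 :=
  h.apply_zero k ▸ h.norm_lt_one k 0 (by simp)

lemma eq_schurApprox (h : IsSchurChain w F) {ζ : ℂ} (hζ : ‖ζ‖ < 1) (n : ℕ) :
    F 0 ζ = schurApprox w ζ n (ζ * F (n + 1) ζ) := by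
  induction n with
  | zero => exact h.eq_mob 0 ζ hζ
  | succ n ih => rw [ih, h.eq_mob (n + 1) ζ hζ]; rfl

/-- The tail ζ F (n + 1) ζ stays in the disk and is forgotten as n grows, so the parameters
determine F 0. -/
lemma eq_schurLimit (h : IsSchurChain w F) {ζ : ℂ} (hζ : ‖ζ‖ < 1) : F 0 ζ = schurLimit w ζ := by
  refine eq_of_sub_eq_zero (norm_le_zero_iff.1 ?_)
  refine ge_of_tendsto (tendsto_two_mul_contractionRate_pow hζ) (.of_forall fun n => ?_)
  rw [h.eq_schurApprox hζ n]
  exact norm_schurApprox_sub_schurLimit_le h.norm_param_lt_one hζ n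
    (norm_lt_one_of_mul hζ (h.norm_lt_one _ ζ hζ).le).le

end IsSchurChain

lemma isSchurChain_schurLimit {w : ℕ → ℂ} (hw : ∀ k, ‖w k‖ < 1) :
    IsSchurChain w fun k => schurLimit fun j => w (j + k) where
  differentiableOn k := differentiableOn_schurLimit fun j => hw (j + k)
  norm_lt_one k ζ hζ := norm_schurLimit_lt_one (fun j => hw (j + k)) hζ
  eq_mob k ζ hζ := by
    rw [schurLimit_eq_mob (fun j => hw (j + k)) hζ]
    simp only [zero_add, add_right_comm, add_assoc]

end DiracSchur

/-! ### Finite Blaschke products as quotients R / R♯ -/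

namespace DiracSchur

open scoped ComplexConjugate
open Polynomial

/-- The polynomial `zⁿ * conj (R (1 / conj z))`. -/
noncomputable def conjReflect (n : ℕ) (R : ℂ[X]) : ℂ[X] := reflect n (R.map (starRingEnd ℂ))

lemma conjReflect_add (n : ℕ) (R S : ℂ[X]) :
    conjReflect n (R + S) = conjReflect n R + conjReflect n S := by
  simp [conjReflect, reflect_add]

lemma conjReflect_sub (n : ℕ) (R S : ℂ[X]) :
    conjReflect n (R - S) = conjReflect n R - conjReflect n S := by
  simp [conjReflect, reflect_sub]

lemma conjReflect_C_mul (n : ℕ) (c : ℂ) (R : ℂ[X]) :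
    conjReflect n (C c * R) = C (conj c) * conjReflect n R := by
  simp [conjReflect, reflect_C_mul]

lemma map_conj_map_conj (R : ℂ[X]) : (R.map (starRingEnd ℂ)).map (starRingEnd ℂ) = R := by
  ext; simp

lemma conjReflect_conjReflect (n : ℕ) (R : ℂ[X]) : conjReflect n (conjReflect n R) = R := by
  rw [conjReflect, conjReflect, ← reflect_map, map_conj_map_conj, reflect_reflect]

lemma natDegree_conjReflect_le {n : ℕ} {R : ℂ[X]} (h : R.natDegree ≤ n) :
    (conjReflect n R).natDegree ≤ n :=
  natDegree_reflect_le.trans (max_le le_rfl (natDegree_map_le.trans h))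

/-- The index is a formal degree: the added factor X uses up the increase from n to n + 1. Without
it, `conjReflect_succ` shows the reflection gaining a factor X. -/
lemma conjReflect_succ_X_mul {n : ℕ} {R : ℂ[X]} (h : R.natDegree ≤ n) :
    conjReflect (n + 1) (X * R) = conjReflect n R := by
  rw [conjReflect, Polynomial.map_mul, map_X, add_comm,
    reflect_mul _ _ natDegree_X_le (natDegree_map_le.trans h), reflect_one_X, one_mul, conjReflect]

lemma conjReflect_succ {n : ℕ} {R : ℂ[X]} (h : R.natDegree ≤ n) :
    conjReflect (n + 1) R = X * conjReflect n R := by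
  rw [conjReflect, ← one_mul (R.map _), add_comm,
    reflect_mul _ _ (by simp) (natDegree_map_le.trans h), reflect_one, pow_one, conjReflect]

lemma conjReflect_prod_X_sub_C {n : ℕ} (a : Fin n → ℂ) :
    conjReflect n (∏ i, (X - C (a i))) = ∏ i, (1 - C (conj (a i)) * X) := by
  induction n with
  | zero => simp [conjReflect]
  | succ n ih =>
    have hd : (∏ i : Fin n, (X - C (a i.succ))).natDegree ≤ n := by simp
    rw [Fin.prod_univ_succ, Fin.prod_univ_succ, sub_mul, conjReflect_sub, conjReflect_C_mul,
      conjReflect_succ_X_mul hd, conjReflect_succ hd, ih fun i => a i.succ]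
    ring

/-- `F` is, on the unit disk, a unimodular multiple of `R / R♯` with `R` a polynomial of degree `n`
all of whose zeros lie in the unit disk. -/
def IsBlaschkeQuotient (n : ℕ) (F : ℂ → ℂ) : Prop :=
  ∃ (c : ℂ) (R : ℂ[X]), ‖c‖ = 1 ∧ R.natDegree = n ∧ (∀ z : ℂ, 1 ≤ ‖z‖ → R.eval z ≠ 0) ∧
    ∀ z : ℂ, ‖z‖ < 1 → F z = c * R.eval z / (conjReflect n R).eval z

lemma exists_eq_C_mul_prod {n : ℕ} {R : ℂ[X]} (hn : R.natDegree = n)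
    (hR : ∀ z : ℂ, 1 ≤ ‖z‖ → R.eval z ≠ 0) :
    ∃ (μ : ℂ) (a : Fin n → ℂ), μ ≠ 0 ∧ (∀ i, ‖a i‖ < 1) ∧ R = C μ * ∏ i, (X - C (a i)) := by
  have hs := IsAlgClosed.splits R
  have h0 : R ≠ 0 := fun h => hR 1 (by simp) (by simp [h])
  obtain ⟨l, hl⟩ : ∃ l : List ℂ, (l : Multiset ℂ) = R.roots := Quot.exists_rep _
  have hlen : l.length = n := by
    rw [← hn, hs.natDegree_eq_card_roots, ← hl, Multiset.coe_card]
  subst hlen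
  refine ⟨R.leadingCoeff, l.get, leadingCoeff_ne_zero.2 h0, fun i => ?_, ?_⟩
  · by_contra! h
    have : l.get i ∈ R.roots := by rw [← hl]; exact List.get_mem l i
    exact hR _ h (isRoot_of_mem_roots this)
  · conv_lhs => rw [hs.eq_prod_roots, ← hl, Multiset.map_coe, Multiset.prod_coe]
    rw [← List.prod_ofFn]
    congr 2
    conv_lhs => rw [← List.ofFn_get l, List.map_ofFn]
    rfl

section Roots

variable {n : ℕ} {R : ℂ[X]}

lemma eval_conjReflect_ne_zero (hn : R.natDegree = n) (hR : ∀ z : ℂ, 1 ≤ ‖z‖ → R.eval z ≠ 0)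
    {z : ℂ} (hz : ‖z‖ < 1) : (conjReflect n R).eval z ≠ 0 := by
  obtain ⟨μ, a, hμ, ha, rfl⟩ := exists_eq_C_mul_prod hn hR
  rw [conjReflect_C_mul, conjReflect_prod_X_sub_C, eval_mul, eval_C, eval_prod]
  refine mul_ne_zero (by simpa using hμ) (Finset.prod_ne_zero_iff.2 fun i _ => ?_)
  have := one_add_conj_mul_ne_zero (w := -a i) (by simpa using ha i) hz.le
  simpa [sub_eq_add_neg] using this

/-- The difference of the squares is (1 - |a|²)(|z|² - 1). -/
lemma norm_one_sub_conj_mul_le {a z : ℂ} (ha : ‖a‖ < 1) (hz : 1 ≤ ‖z‖) :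
    ‖1 - conj a * z‖ ≤ ‖z - a‖ := by
  refine le_of_sq_le_sq ?_ (by positivity)
  have h1 : a.re ^ 2 + a.im ^ 2 ≤ 1 := by
    have h := Complex.sq_norm a
    rw [Complex.normSq_apply] at h
    nlinarith [norm_nonneg a]
  have h2 : 1 ≤ z.re ^ 2 + z.im ^ 2 := by
    have h := Complex.sq_norm z
    rw [Complex.normSq_apply] at h
    nlinarith [norm_nonneg z]
  rw [Complex.sq_norm, Complex.sq_norm, Complex.normSq_apply, Complex.normSq_apply]
  simp
  nlinarith [mul_nonneg (by linarith : 0 ≤ 1 - (a.re ^ 2 + a.im ^ 2))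
    (by linarith : 0 ≤ z.re ^ 2 + z.im ^ 2 - 1)]

lemma norm_eval_conjReflect_le (hn : R.natDegree = n) (hR : ∀ z : ℂ, 1 ≤ ‖z‖ → R.eval z ≠ 0)
    {z : ℂ} (hz : 1 ≤ ‖z‖) : ‖(conjReflect n R).eval z‖ ≤ ‖R.eval z‖ := by
  obtain ⟨μ, a, hμ, ha, rfl⟩ := exists_eq_C_mul_prod hn hR
  rw [conjReflect_C_mul, conjReflect_prod_X_sub_C]
  simp only [eval_mul, eval_C, eval_prod, norm_mul, Complex.norm_conj, norm_prod, eval_sub,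
    eval_one, eval_X]
  gcongr with i
  exact norm_one_sub_conj_mul_le (ha i) hz

/-- Strict domination outside the disk: adding w R♯ to R creates no zeros there. -/
lemma norm_mul_eval_conjReflect_lt (hn : R.natDegree = n)
    (hR : ∀ z : ℂ, 1 ≤ ‖z‖ → R.eval z ≠ 0) {w z : ℂ} (hw : ‖w‖ < 1) (hz : 1 ≤ ‖z‖) :
    ‖w * (conjReflect n R).eval z‖ < ‖R.eval z‖ := by
  have h1 := norm_eval_conjReflect_le hn hR hz
  have h2 := norm_pos_iff.2 (hR z hz)
  rw [norm_mul]
  nlinarith [norm_nonneg w]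

end Roots

lemma isFiniteBlaschkeProduct_iff {F : ℂ → ℂ} :
    IsFiniteBlaschkeProduct F ↔ ∃ n, IsBlaschkeQuotient n F := by
  constructor
  · rintro ⟨c, n, a, hc, ha, h⟩
    refine ⟨n, c, ∏ i, (X - C (a i)), hc, by simp, fun z hz => ?_, fun z hz => ?_⟩
    · rw [eval_prod]
      refine Finset.prod_ne_zero_iff.2 fun i _ h0 => ?_
      simp only [eval_sub, eval_X, eval_C, sub_eq_zero] at h0
      exact (ha i).not_ge (h0 ▸ hz)
    · rw [h z (by simpa using hz), conjReflect_prod_X_sub_C, Finset.prod_div_distrib, mul_div_assoc]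
      simp [eval_prod]
  · rintro ⟨n, c, R, hc, hn, hR, h⟩
    obtain ⟨μ, a, hμ, ha, rfl⟩ := exists_eq_C_mul_prod hn hR
    -- Reflection conjugates the leading coefficient μ, so the constant changes by the unimodular
    -- factor μ / conj μ.
    refine ⟨c * (μ / conj μ), n, a, ?_, ha, fun z hz => ?_⟩
    · simp [hc, hμ]
    · rw [h z (by simpa using hz), conjReflect_C_mul, conjReflect_prod_X_sub_C,
        Finset.prod_div_distrib]
      simp only [eval_mul, eval_C, eval_prod, eval_sub, eval_one, eval_X]
      ring

lemma conj_mul_self_of_norm_eq_one {c : ℂ} (hc : ‖c‖ = 1) : conj c * c = 1 := by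
  rw [Complex.conj_mul', hc]; simp

lemma div_mul_of_norm_eq_one {c : ℂ} (hc : ‖c‖ = 1) (x y : ℂ) :
    x / (c * y) = conj c * x / y := by
  rw [eq_inv_of_mul_eq_one_left (conj_mul_self_of_norm_eq_one hc), div_eq_mul_inv, mul_inv]
  ring

/-- With G = cR/R♯ the numerator of F is cXR + wR♯, and the denominator is c times its reflection of
formal degree n + 1. For |z| ≥ 1, |wR♯| < |R| ≤ |zR| excludes zeros. -/
lemma IsBlaschkeQuotient.mob_mul {n : ℕ} {F G : ℂ → ℂ} {w : ℂ} (hw : ‖w‖ < 1)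
    (hG : IsBlaschkeQuotient n G) (h : ∀ ζ : ℂ, ‖ζ‖ < 1 → F ζ = mob w (ζ * G ζ)) :
    IsBlaschkeQuotient (n + 1) F := by
  obtain ⟨c, R, hc, hn, hR, hGR⟩ := hG
  have hc0 : c ≠ 0 := norm_pos_iff.1 (hc ▸ one_pos)
  have hR0 : R ≠ 0 := fun h => hR 1 (by simp) (by simp [h])
  refine ⟨conj c, C c * (X * R) + C w * conjReflect n R, by simpa using hc, ?_,
    fun z hz h0 => ?_, fun z hz => ?_⟩
  · have h1 : (C c * (X * R)).natDegree = n + 1 := by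
      rw [natDegree_C_mul hc0, natDegree_X_mul hR0, hn]
    rw [natDegree_add_eq_left_of_natDegree_lt, h1]
    rw [h1]
    exact ((natDegree_C_mul_le _ _).trans (natDegree_conjReflect_le hn.le)).trans_lt n.lt_succ_self
  · have h1 := norm_mul_eval_conjReflect_lt hn hR hw hz
    simp only [eval_add, eval_mul, eval_C, eval_X] at h0
    have h2 : ‖w * (conjReflect n R).eval z‖ = ‖z‖ * ‖R.eval z‖ := by
      rw [← neg_eq_of_add_eq_zero_right h0]
      simp [hc]
    rw [h2] at h1
    nlinarith [norm_nonneg (R.eval z)]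
  · have h1 := eval_conjReflect_ne_zero hn hR hz
    have e : conjReflect (n + 1) (C c * (X * R) + C w * conjReflect n R) =
        C (conj c) * conjReflect n R + C (conj w) * (X * R) := by
      rw [conjReflect_add, conjReflect_C_mul, conjReflect_C_mul, conjReflect_succ_X_mul hn.le,
        conjReflect_succ (natDegree_conjReflect_le hn.le), conjReflect_conjReflect]
    rw [h z hz, hGR z hz, e, mob]
    simp only [eval_add, eval_mul, eval_C, eval_X]
    have e1 : z * (c * R.eval z / (conjReflect n R).eval z) + w =
        (c * (z * R.eval z) + w * (conjReflect n R).eval z) / (conjReflect n R).eval z := by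
      field_simp
    have e2 : 1 + conj w * (z * (c * R.eval z / (conjReflect n R).eval z)) =
        c * (conj c * (conjReflect n R).eval z + conj w * (z * R.eval z)) /
          (conjReflect n R).eval z := by
      rw [mul_add c, ← mul_assoc c (conj c), mul_comm c (conj c), conj_mul_self_of_norm_eq_one hc]
      field_simp
    rw [e1, e2, div_div_div_cancel_right₀ h1, div_mul_of_norm_eq_one hc]

/-- Since F 0 = w, the polynomial cR - wR♯ vanishes at 0; removing its factor X gives the numerator
of G, of degree one less. -/
lemma IsBlaschkeQuotient.of_mob_mul {n : ℕ} {F G : ℂ → ℂ} {w : ℂ} (hw : ‖w‖ < 1)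
    (hF : IsBlaschkeQuotient (n + 1) F) (hG : ∀ ζ : ℂ, ‖ζ‖ < 1 → ‖G ζ‖ ≤ 1)
    (hG0 : ContinuousAt G 0) (h : ∀ ζ : ℂ, ‖ζ‖ < 1 → F ζ = mob w (ζ * G ζ)) :
    IsBlaschkeQuotient n G := by
  obtain ⟨c, R, hc, hn, hR, hFR⟩ := hF
  have hc0 : c ≠ 0 := norm_pos_iff.1 (hc ▸ one_pos)
  have hR0 : R ≠ 0 := fun h => hR 1 (by simp) (by simp [h])
  have hz0 : ‖(0 : ℂ)‖ < 1 := by simp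
  have hF0 : c * R.eval 0 = w * (conjReflect (n + 1) R).eval 0 := by
    have h1 := hFR 0 hz0
    rw [h 0 hz0, zero_mul, mob_zero] at h1
    rw [h1, div_mul_cancel₀ _ (eval_conjReflect_ne_zero hn hR hz0)]
  set T : ℂ[X] := C c * R - C w * conjReflect (n + 1) R with hT
  obtain ⟨S, hS⟩ : X ∣ T := by
    rw [X_dvd_iff, coeff_zero_eq_eval_zero, hT]
    simp [hF0]
  have hTz : ∀ z : ℂ, 1 ≤ ‖z‖ → T.eval z ≠ 0 := fun z hz h0 => by
    have h1 := norm_mul_eval_conjReflect_lt hn hR hw hz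
    simp only [hT, eval_sub, eval_mul, eval_C, sub_eq_zero] at h0
    rw [← h0, norm_mul, hc, one_mul] at h1
    exact h1.false
  have hTn : T.natDegree = n + 1 := by
    refine natDegree_eq_of_le_of_coeff_ne_zero ?_ fun h0 => ?_
    · refine (natDegree_sub_le _ _).trans (max_le ?_ ?_)
      · exact (natDegree_C_mul_le _ _).trans hn.le
      · exact (natDegree_C_mul_le _ _).trans (natDegree_conjReflect_le hn.le)
    -- If the top coefficient of T vanished, then together with T(0) = 0 each of |R(0)| and |lead R|
    -- would be |w| times the other, forcing lead R = 0.
    · have e1 : (conjReflect (n + 1) R).coeff (n + 1) = conj (R.eval 0) := by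
        rw [conjReflect, coeff_reflect, revAt_le le_rfl, Nat.sub_self, coeff_map,
          coeff_zero_eq_eval_zero]
      have e2 : (conjReflect (n + 1) R).eval 0 = conj (R.coeff (n + 1)) := by
        rw [← coeff_zero_eq_eval_zero, conjReflect, coeff_reflect, revAt_le (Nat.zero_le _),
          Nat.sub_zero, coeff_map]
      have e3 : ‖R.eval 0‖ = ‖w‖ * ‖R.coeff (n + 1)‖ := by
        have := congrArg norm hF0
        rwa [e2, norm_mul, norm_mul, Complex.norm_conj, hc, one_mul] at this
      simp only [hT, coeff_sub, coeff_C_mul, e1, sub_eq_zero] at h0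
      have e4 : ‖R.coeff (n + 1)‖ = ‖w‖ * ‖R.eval 0‖ := by
        have := congrArg norm h0
        rwa [norm_mul, norm_mul, Complex.norm_conj, hc, one_mul] at this
      have e5 : 0 < ‖R.coeff (n + 1)‖ := by
        rw [← hn]
        exact norm_pos_iff.2 (leadingCoeff_ne_zero.2 hR0)
      nlinarith [norm_nonneg w, norm_nonneg (R.eval 0)]
  have hS0 : S ≠ 0 := fun h0 => hTz 1 (by simp) (by simp [hS, h0])
  have hSn : S.natDegree = n := by
    rw [hS, natDegree_X_mul hS0] at hTn
    omega
  have hSz : ∀ z : ℂ, 1 ≤ ‖z‖ → S.eval z ≠ 0 := fun z hz h0 => hTz z hz (by simp [hS, h0])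
  have hSr : conjReflect n S = C (conj c) * conjReflect (n + 1) R - C (conj w) * R := by
    rw [← conjReflect_succ_X_mul hSn.le, ← hS, hT, conjReflect_sub, conjReflect_C_mul,
      conjReflect_C_mul, conjReflect_conjReflect]
  have key : ∀ z : ℂ, ‖z‖ < 1 → z ≠ 0 →
      G z = conj c * S.eval z / (conjReflect n S).eval z := fun z hz hz' => by
    have h1 := eval_conjReflect_ne_zero hn hR hz
    have h2 := eval_conjReflect_ne_zero hSn hSz hz
    have hG1 := sub_mob_div hw (norm_lt_one_of_mul hz (hG z hz)).le
    rw [← h z hz, hFR z hz] at hG1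
    have e1 : c * R.eval z / (conjReflect (n + 1) R).eval z - w =
        z * S.eval z / (conjReflect (n + 1) R).eval z := by
      have : z * S.eval z = c * R.eval z - w * (conjReflect (n + 1) R).eval z := by
        have := congrArg (eval z) hS
        simpa [hT] using this.symm
      rw [this]
      field_simp
    have e2 : 1 - conj w * (c * R.eval z / (conjReflect (n + 1) R).eval z) =
        c * (conjReflect n S).eval z / (conjReflect (n + 1) R).eval z := by
      rw [hSr]
      simp only [eval_sub, eval_mul, eval_C]
      rw [mul_sub c, ← mul_assoc c (conj c), mul_comm c (conj c), conj_mul_self_of_norm_eq_one hc]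
      field_simp
    rw [e1, e2, div_div_div_cancel_right₀ h1] at hG1
    refine mul_left_cancel₀ hz' ?_
    rw [← hG1, div_mul_of_norm_eq_one hc]
    ring
  refine ⟨conj c, S, by simpa using hc, hSn, hSz, fun z hz => ?_⟩
  -- Division by z loses the point 0; both sides are continuous there.
  rcases eq_or_ne z 0 with rfl | hz'
  · have h2 := eval_conjReflect_ne_zero hSn hSz hz
    have hcont : ContinuousAt (fun z => conj c * S.eval z / (conjReflect n S).eval z) 0 :=
      (continuousAt_const.mul S.continuous.continuousAt).div
        (conjReflect n S).continuous.continuousAt h2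
    refine tendsto_nhds_unique (hG0.tendsto.mono_left nhdsWithin_le_nhds)
      ((hcont.tendsto.mono_left nhdsWithin_le_nhds).congr' ?_) (l := 𝓝[≠] 0)
    filter_upwards [self_mem_nhdsWithin,
      nhdsWithin_le_nhds (Metric.ball_mem_nhds (0 : ℂ) one_pos)] with z h3 h4
    exact (key z (by simpa using h4) h3).symm
  · exact key z hz hz'

/-! ### Schur's algorithm on functions that are not finite Blaschke products -/

lemma IsSchurChain.not_isBlaschkeQuotient {w : ℕ → ℂ} {F : ℕ → ℂ → ℂ} (h : IsSchurChain w F)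
    (n k : ℕ) : ¬ IsBlaschkeQuotient n (F k) := by
  induction n generalizing k with
  | zero =>
    -- A quotient of degree 0 is a unimodular constant, while members of a chain are strictly below
    -- 1 in modulus.
    rintro ⟨c, R, hc, hn, hR, hF⟩
    have h1 := h.norm_lt_one k 0 (by simp)
    rw [hF 0 (by simp), eq_C_of_natDegree_eq_zero hn] at h1
    have h0 : R.coeff 0 ≠ 0 := by
      have := hR 1 (by simp)
      rwa [eq_C_of_natDegree_eq_zero hn, eval_C] at this
    simp [conjReflect, hc, h0] at h1
  | succ n ih =>
    intro hF
    refine ih (k + 1) (hF.of_mob_mul (h.norm_param_lt_one k)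
      (fun ζ hζ => (h.norm_lt_one _ ζ hζ).le) ?_ (h.eq_mob k))
    exact ((h.differentiableOn (k + 1) 0 (by simp)).differentiableAt
      (Metric.ball_mem_nhds _ one_pos)).continuousAt

lemma IsSchurChain.mem_schurClassDisk {w : ℕ → ℂ} {F : ℕ → ℂ → ℂ} (h : IsSchurChain w F) :
    F 0 ∈ schurClassDisk := by
  refine ⟨h.differentiableOn 0, fun ζ hζ => (h.norm_lt_one 0 ζ (by simpa using hζ)).le, ?_⟩
  rw [isFiniteBlaschkeProduct_iff]
  rintro ⟨n, hn⟩
  exact h.not_isBlaschkeQuotient n 0 hn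

/-- By the maximum principle, modulus 1 at an interior point forces a unimodular constant, a
Blaschke product of degree 0. -/
lemma norm_lt_one_of_mem_schurClassDisk {F : ℂ → ℂ} (hF : F ∈ schurClassDisk) {ζ : ℂ}
    (hζ : ‖ζ‖ < 1) : ‖F ζ‖ < 1 := by
  obtain ⟨hd, h1, hB⟩ := hF
  have hζ' : ζ ∈ Metric.ball (0 : ℂ) 1 := by simpa using hζ
  refine lt_of_le_of_ne (h1 ζ hζ') fun he => hB ?_
  have hm : IsMaxOn (norm ∘ F) (Metric.ball 0 1) ζ := fun z hz => by
    simpa [he] using h1 z hz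
  have hc := Complex.eqOn_of_isPreconnected_of_isMaxOn_norm
    (convex_ball (0 : ℂ) 1).isPreconnected Metric.isOpen_ball hd hζ' hm
  exact ⟨F ζ, 0, Fin.elim0, he, fun i => i.elim0, fun z hz => by simpa using hc hz⟩

/-- Schwarz's lemma for H, which is F followed by the automorphism sending F 0 to 0: G is H(ζ)/ζ
with the singularity removed. Were G a finite Blaschke product, F would be one of degree one higher.
-/
lemma exists_schur_step {F : ℂ → ℂ} (hF : F ∈ schurClassDisk) :
    ∃ G ∈ schurClassDisk, ∀ ζ : ℂ, ‖ζ‖ < 1 → F ζ = mob (F 0) (ζ * G ζ) := by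
  have hlt : ∀ ζ : ℂ, ‖ζ‖ < 1 → ‖F ζ‖ < 1 := fun ζ => norm_lt_one_of_mem_schurClassDisk hF
  have hw : ‖F 0‖ < 1 := hlt 0 (by simp)
  set H : ℂ → ℂ := fun ζ => (F ζ - F 0) / (1 - conj (F 0) * F ζ) with hH
  have hHd : DifferentiableOn ℂ H (Metric.ball 0 1) := by
    refine (hF.1.sub_const _).div ((hF.1.const_mul _).const_sub 1) fun ζ hζ => ?_
    rw [sub_eq_add_neg, ← mul_neg]
    exact one_add_conj_mul_ne_zero hw (by simpa using (hlt ζ (by simpa using hζ)).le)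
  have hH0 : H 0 = 0 := by simp [hH]
  have hHm : MapsTo H (Metric.ball 0 1) (Metric.ball (H 0) 1) := fun ζ hζ => by
    rw [hH0, mem_ball_zero_iff]
    exact norm_sub_div_lt_one hw (hlt ζ (by simpa using hζ))
  have hmul : ∀ ζ : ℂ, ζ * dslope H 0 ζ = H ζ := fun ζ => by
    have := sub_smul_dslope H 0 ζ
    simpa [hH0] using this
  have hG1 : ∀ ζ ∈ Metric.ball (0 : ℂ) 1, ‖dslope H 0 ζ‖ ≤ 1 := fun ζ hζ => by
    simpa using Complex.norm_dslope_le_div_of_mapsTo_ball hHd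
      (hHm.mono_right Metric.ball_subset_closedBall) hζ
  have hstep : ∀ ζ : ℂ, ‖ζ‖ < 1 → F ζ = mob (F 0) (ζ * dslope H 0 ζ) := fun ζ hζ => by
    rw [hmul, hH, mob_sub_div hw (hlt ζ hζ).le]
  refine ⟨dslope H 0, ⟨?_, hG1, fun hB => hF.2.2 ?_⟩, hstep⟩
  · exact (Complex.differentiableOn_dslope (Metric.ball_mem_nhds _ one_pos)).2 hHd
  · obtain ⟨n, hn⟩ := isFiniteBlaschkeProduct_iff.1 hB
    exact isFiniteBlaschkeProduct_iff.2 ⟨n + 1, hn.mob_mul hw hstep⟩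

/-- Schur's algorithm does not terminate on functions that are not finite Blaschke products. -/
lemma exists_isSchurChain {F : ℂ → ℂ} (hF : F ∈ schurClassDisk) :
    ∃ (w : ℕ → ℂ) (G : ℕ → ℂ → ℂ), IsSchurChain w G ∧ G 0 = F := by
  choose! next hnext hstep using fun F : ℂ → ℂ => exists_schur_step (F := F)
  have hmem : ∀ k, next^[k] F ∈ schurClassDisk := fun k => by
    induction k with
    | zero => exact hF
    | succ k ih => rw [Function.iterate_succ_apply']; exact hnext _ ih
  refine ⟨fun k => next^[k] F 0, fun k => next^[k] F, ⟨fun k => (hmem k).1,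
    fun k ζ hζ => norm_lt_one_of_mem_schurClassDisk (hmem k) hζ, fun k ζ hζ => ?_⟩, rfl⟩
  rw [Function.iterate_succ_apply']
  exact hstep _ (hmem k) ζ hζ

end DiracSchur

/-! ### Measures supported on the half-lattice -/

namespace DiracSchur

open Classical in
lemma sum_dirac_apply {ι : Type*} (s : Finset ι) (a : ι → ℝ) (c : ι → ℂ) {A : Set ℝ}
    (hA : MeasurableSet A) :
    (∑ k ∈ s, VectorMeasure.dirac (a k) (c k)) A = ∑ k ∈ s, if a k ∈ A then c k else 0 := by
  induction s using Finset.induction_on with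
  | empty => simp
  | insert i s hi ih =>
    rw [Finset.sum_insert hi, Finset.sum_insert hi, FunLike.coe_add, Pi.add_apply, ih]
    congr 1
    split_ifs with h
    · exact VectorMeasure.dirac_apply_of_mem hA h
    · exact VectorMeasure.dirac_apply_of_notMem h

open Classical in
/-- The indices of the points of the half-lattice `ℓℤ₊` in `(-∞, x]`. -/
noncomputable def latticeIndices (ℓ x : ℝ) : Finset ℕ :=
  (Finset.range (⌊x / ℓ⌋₊ + 1)).filter fun k => ℓ * (k : ℝ) ≤ x

lemma mem_latticeIndices {ℓ : ℝ} (hℓ : 0 < ℓ) {x : ℝ} {k : ℕ} :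
    k ∈ latticeIndices ℓ x ↔ ℓ * (k : ℝ) ≤ x := by
  rw [latticeIndices, Finset.mem_filter, Finset.mem_range, and_iff_right_iff_imp]
  intro h
  rw [Nat.lt_succ_iff]
  exact Nat.le_floor (by rwa [le_div_iff₀' hℓ])

lemma latticeIndices_of_neg {ℓ : ℝ} (hℓ : 0 < ℓ) {x : ℝ} (hx : x < 0) :
    latticeIndices ℓ x = ∅ := by
  ext k
  rw [mem_latticeIndices hℓ]
  simpa using hx.trans_le (by positivity)

lemma latticeIndices_eq_range {ℓ : ℝ} (hℓ : 0 < ℓ) {x : ℝ} {n : ℕ} (h1 : ℓ * n ≤ x)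
    (h2 : x < ℓ * (n + 1 : ℕ)) : latticeIndices ℓ x = Finset.range (n + 1) := by
  ext k
  rw [mem_latticeIndices hℓ, Finset.mem_range, Nat.lt_succ_iff]
  constructor
  · intro h
    have : (k : ℝ) < (n + 1 : ℕ) := lt_of_mul_lt_mul_left (h.trans_lt h2) hℓ.le
    exact Nat.lt_succ_iff.1 (by exact_mod_cast this)
  · intro h
    refine le_trans ?_ h1
    gcongr

lemma mul_natCast_injective {ℓ : ℝ} (hℓ : 0 < ℓ) : Function.Injective fun k : ℕ => ℓ * (k : ℝ) :=
  fun j k h => by simpa [hℓ.ne'] using h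

namespace LocalComplexMeasure

lemma upTo_inter_Iic (q : LocalComplexMeasure) {x y : ℝ} (hxy : x ≤ y) {A : Set ℝ}
    (hA : MeasurableSet A) : q.upTo y (A ∩ Iic x) = q.upTo x A := by
  rw [← q.restrict_upTo x y hxy, VectorMeasure.restrict_apply _ measurableSet_Iic hA]

lemma upTo_singleton (q : LocalComplexMeasure) {x y : ℝ} (hxy : x ≤ y) :
    q.upTo y {x} = q.atom x := by
  rw [atom, ← q.upTo_inter_Iic hxy (measurableSet_singleton x), inter_eq_left.2 (by simp)]

/-- A measure supported on the half-lattice is the sum of its point masses. -/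
lemma upTo_eq_sum_dirac {q : LocalComplexMeasure} {ℓ : ℝ} (hℓ : 0 < ℓ)
    (hq : q.SupportedOnLattice ℓ) (x : ℝ) :
    q.upTo x = ∑ k ∈ latticeIndices ℓ x, VectorMeasure.dirac (ℓ * (k : ℝ)) (q.atom (ℓ * k)) := by
  classical
  ext1 A hA
  rw [sum_dirac_apply _ _ _ hA, ← q.upTo_inter_Iic le_rfl hA]
  set B : Set ℝ := ⋃ k ∈ latticeIndices ℓ x, A ∩ {ℓ * (k : ℝ)} with hB
  have hBm : MeasurableSet B :=
    Finset.measurableSet_biUnion _ fun k _ => hA.inter (measurableSet_singleton _)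
  have hBA : B ⊆ A ∩ Iic x := by
    intro y hy
    simp only [hB, mem_iUnion, mem_inter_iff, mem_singleton_iff, exists_prop] at hy
    obtain ⟨k, hk, hyA, rfl⟩ := hy
    exact ⟨hyA, (mem_latticeIndices hℓ).1 hk⟩
  -- Outside its lattice points, A ∩ (-∞, x] misses the half-lattice, so q gives it no mass.
  have hdisj : Disjoint ((A ∩ Iic x) \ B) (halfLattice ℓ) := by
    rw [Set.disjoint_left]
    rintro y ⟨⟨hyA, hyx⟩, hyB⟩ ⟨k, rfl⟩
    refine hyB (mem_biUnion (x := k) ?_ ⟨hyA, rfl⟩)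
    exact (mem_latticeIndices hℓ).2 hyx
  rw [← VectorMeasure.of_add_of_sdiff hBm (hA.inter measurableSet_Iic) hBA,
    hq x _ ((hA.inter measurableSet_Iic).diff hBm) hdisj, add_zero, hB,
    VectorMeasure.of_biUnion_finset]
  · refine Finset.sum_congr rfl fun k hk => ?_
    split_ifs with h
    · rw [inter_eq_right.2 (singleton_subset_iff.2 h),
        q.upTo_singleton ((mem_latticeIndices hℓ).1 hk)]
    · rw [inter_singleton_eq_empty.2 h, VectorMeasure.empty]
  · intro j _ k _ hjk
    refine Disjoint.mono inter_subset_right inter_subset_right ?_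
    simpa [hℓ.ne'] using hjk
  · exact fun k _ => hA.inter (measurableSet_singleton _)

lemma ext_of_atom {q p : LocalComplexMeasure} {ℓ : ℝ} (hℓ : 0 < ℓ) (hq : q.SupportedOnLattice ℓ)
    (hp : p.SupportedOnLattice ℓ) (h : ∀ k : ℕ, q.atom (ℓ * k) = p.atom (ℓ * k)) : q = p := by
  refine LocalComplexMeasure.ext (funext fun x => ?_)
  simp only [upTo_eq_sum_dirac hℓ hq, upTo_eq_sum_dirac hℓ hp, h]

/-- The measure `∑ c k δ_{ℓk}`. -/
noncomputable def ofAtoms {ℓ : ℝ} (hℓ : 0 < ℓ) (c : ℕ → ℂ) : LocalComplexMeasure where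
  upTo x := ∑ k ∈ latticeIndices ℓ x, VectorMeasure.dirac (ℓ * (k : ℝ)) (c k)
  restrict_upTo x y hxy := by
    classical
    ext1 A hA
    rw [VectorMeasure.restrict_apply _ measurableSet_Iic hA,
      sum_dirac_apply _ _ _ (hA.inter measurableSet_Iic), sum_dirac_apply _ _ _ hA]
    symm
    refine Finset.sum_subset_zero_on_sdiff (fun k hk => ?_) (fun k hk => ?_) fun k hk => ?_
    · exact (mem_latticeIndices hℓ).2 (((mem_latticeIndices hℓ).1 hk).trans hxy)
    · rw [Finset.mem_sdiff, mem_latticeIndices hℓ, mem_latticeIndices hℓ] at hk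
      exact if_neg fun h => hk.2 h.2
    · rw [mem_latticeIndices hℓ] at hk
      simp [hk]
  upTo_of_neg x hx := by rw [latticeIndices_of_neg hℓ hx, Finset.sum_empty]

lemma supportedOnLattice_ofAtoms {ℓ : ℝ} (hℓ : 0 < ℓ) (c : ℕ → ℂ) :
    (ofAtoms hℓ c).SupportedOnLattice ℓ := fun x A hA hd => by
  classical
  refine (sum_dirac_apply _ _ _ hA).trans (Finset.sum_eq_zero fun k _ => if_neg fun h => ?_)
  exact Set.disjoint_left.1 hd h ⟨k, rfl⟩

lemma atom_ofAtoms {ℓ : ℝ} (hℓ : 0 < ℓ) (c : ℕ → ℂ) (k : ℕ) :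
    (ofAtoms hℓ c).atom (ℓ * k) = c k := by
  classical
  refine (sum_dirac_apply _ _ _ (measurableSet_singleton _)).trans ?_
  rw [Finset.sum_eq_single k]
  · simp
  · exact fun j _ hj => if_neg fun h => hj (mul_natCast_injective hℓ h)
  · exact fun h => (h ((mem_latticeIndices hℓ).2 le_rfl)).elim

end LocalComplexMeasure

lemma potential_apply_eq_sum_dirac {q : LocalComplexMeasure} {ℓ : ℝ} (hℓ : 0 < ℓ)
    (hq : q.SupportedOnLattice ℓ) (x : ℝ) (k l : Fin 2) :
    potential q x k l = ∑ n ∈ latticeIndices ℓ x,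
      VectorMeasure.dirac (ℓ * (n : ℝ)) (potentialAtom q (ℓ * n) k l).re := by
  have hre : ∀ (a : ℝ) (c : ℂ),
      ComplexMeasure.re (VectorMeasure.dirac a c) = VectorMeasure.dirac a c.re := fun a c => by
    ext A hA
    change (VectorMeasure.dirac a c A).re = _
    by_cases h : a ∈ A <;> simp [h, hA]
  have him : ∀ (a : ℝ) (c : ℂ),
      ComplexMeasure.im (VectorMeasure.dirac a c) = VectorMeasure.dirac a c.im := fun a c => by
    ext A hA
    change (VectorMeasure.dirac a c A).im = _
    by_cases h : a ∈ A <;> simp [h, hA]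
  have hneg : ∀ a r : ℝ, -VectorMeasure.dirac a r = VectorMeasure.dirac a (-r) := fun a r => by
    ext A hA
    by_cases h : a ∈ A <;> simp [h, hA]
  fin_cases k <;> fin_cases l <;>
    simp [potential, potentialAtom, q.upTo_eq_sum_dirac hℓ hq x, map_sum, hre, him, hneg,
      ← Finset.sum_neg_distrib]

/-- The mass `g(Q({x}) J*) Q({x})` of the coefficient of the integral equation. -/
noncomputable def jumpCoeff (q : LocalComplexMeasure) (x : ℝ) : Matrix (Fin 2) (Fin 2) ℂ :=
  perssonG (potentialAtom q x * J.conjTranspose) * potentialAtom q x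

lemma potentialIntegral_eq_sum {q : LocalComplexMeasure} {ℓ : ℝ} (hℓ : 0 < ℓ)
    (hq : q.SupportedOnLattice ℓ) (N : ℝ → Matrix (Fin 2) (Fin 2) ℂ) (x : ℝ) :
    potentialIntegral q N x =
      ∑ n ∈ latticeIndices ℓ x, jumpCoeff q (ℓ * n) * N (ℓ * n) := by
  have hint : ∀ (f : ℝ → ℂ) (k l : Fin 2),
      (∫ᵛ t, f t ∂<•(potential q x k l)) =
        ∑ n ∈ latticeIndices ℓ x, potentialAtom q (ℓ * n) k l * f (ℓ * n) := fun f k l => by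
    have hreal : ∀ t, (((potentialAtom q t k l).re : ℝ) : ℂ) = potentialAtom q t k l := fun t => by
      fin_cases k <;> fin_cases l <;> simp [potentialAtom]
    rw [potential_apply_eq_sum_dirac hℓ hq, VectorMeasure.integral_finsetSum_vectorMeasure]
    · refine Finset.sum_congr rfl fun n _ => ?_
      rw [VectorMeasure.integral_dirac]
      simp [hreal]
    · intro n _
      rw [VectorMeasure.Integrable, VectorMeasure.variation_dirac]
      exact (integrable_dirac (by simp)).smul_measure (by simp)
  ext i j
  simp only [potentialIntegral, Matrix.of_apply, hint, Matrix.sum_apply, Matrix.mul_apply,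
    jumpCoeff]
  simp only [Fin.sum_univ_two, ← Finset.sum_add_distrib]
  exact Finset.sum_congr rfl fun n _ => by ring

end DiracSchur

/-! ### Jump matrices and free rotation -/

namespace DiracSchur

/-- The matrix `J Q = Q J*` of the potential `c`. -/
noncomputable def potentialGenerator (c : ℂ) : Matrix (Fin 2) (Fin 2) ℂ :=
  !![-(c.re : ℂ), (c.im : ℂ); (c.im : ℂ), (c.re : ℂ)]

/-- The matrix `exp (J Q)` of the potential `c`, by which a solution is multiplied at a point of
mass `c`. -/
noncomputable def jumpMatrix (c : ℂ) : Matrix (Fin 2) (Fin 2) ℂ :=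
  Complex.cosh ‖c‖ • 1 + (Complex.sinh ‖c‖ / ‖c‖) • potentialGenerator c

lemma norm_sq_eq_re_add_im (c : ℂ) : (‖c‖ : ℂ) ^ 2 = (c.re : ℂ) ^ 2 + (c.im : ℂ) ^ 2 := by
  have h := Complex.sq_norm c
  rw [Complex.normSq_apply] at h
  have h2 : ‖c‖ ^ 2 = c.re ^ 2 + c.im ^ 2 := by rw [h]; ring
  exact_mod_cast congrArg ((↑) : ℝ → ℂ) h2

lemma potentialGenerator_sq (c : ℂ) :
    potentialGenerator c ^ 2 = ((‖c‖ : ℂ) ^ 2) • (1 : Matrix (Fin 2) (Fin 2) ℂ) := by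
  rw [norm_sq_eq_re_add_im, sq (potentialGenerator c)]
  ext i j
  fin_cases i <;> fin_cases j <;> simp [potentialGenerator, Matrix.mul_apply] <;> ring

/-- Because T² = |c|² I, the even powers sum to cosh |c| and the odd ones to (sinh |c| / |c|) T. -/
lemma hasSum_exp_potentialGenerator (c : ℂ) :
    HasSum (fun n : ℕ => ((n.factorial : ℂ)⁻¹) • potentialGenerator c ^ n) (jumpMatrix c) := by
  set T := potentialGenerator c with hT
  have heven : ∀ n : ℕ, T ^ (2 * n) = ((‖c‖ : ℂ) ^ (2 * n)) • 1 := fun n => by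
    rw [pow_mul, hT, potentialGenerator_sq, smul_pow, one_pow, ← pow_mul]
  have hzero : ‖c‖ = 0 → T = 0 := fun h => by
    rw [norm_eq_zero] at h
    subst h
    ext i j
    fin_cases i <;> fin_cases j <;> simp [hT, potentialGenerator]
  refine HasSum.even_add_odd ?_ ?_
  · convert (Complex.hasSum_cosh ‖c‖).smul_const (1 : Matrix (Fin 2) (Fin 2) ℂ) using 2 with n
    rw [heven, smul_smul, div_eq_inv_mul]
  · convert ((Complex.hasSum_sinh ‖c‖).div_const (‖c‖ : ℂ)).smul_const T using 2 with n
    rcases eq_or_ne ‖c‖ 0 with h | h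
    · simp [hzero h]
    · have h' : (‖c‖ : ℂ) ≠ 0 := by exact_mod_cast h
      rw [pow_succ, heven, smul_mul_assoc, one_mul, smul_smul, pow_succ]
      congr 1
      field_simp

/-- `g(T) T = exp T - 1`. -/
lemma perssonG_mul_self (c : ℂ) :
    perssonG (potentialGenerator c) * potentialGenerator c = jumpMatrix c - 1 := by
  set T := potentialGenerator c with hT
  have h := hasSum_exp_potentialGenerator c
  rcases eq_or_ne c 0 with rfl | hc
  · have : T = 0 := by
      ext i j
      fin_cases i <;> fin_cases j <;> simp [hT, potentialGenerator]
    simp [this, jumpMatrix, ← hT]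
  · have hc' : ((‖c‖ : ℂ) ^ 2) ≠ 0 := by simpa using hc
    -- Here |c|⁻² T is the inverse of T; it lowers each exponent by one and produces the series of
    -- `perssonG`.
    have h2 := ((hasSum_nat_add_iff' 2).2 h).mul_left ((((‖c‖ : ℂ) ^ 2)⁻¹) • T)
    have e : (fun n : ℕ => ((((‖c‖ : ℂ) ^ 2)⁻¹) • T) *
        ((((n + 2).factorial : ℂ)⁻¹) • T ^ (n + 2))) =
        fun n : ℕ => (((n + 2).factorial : ℂ)⁻¹) • T ^ (n + 1) := by
      funext n
      rw [smul_mul_smul_comm, ← pow_succ', show n + 2 + 1 = 2 + (n + 1) by ring, pow_add T 2,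
        hT, potentialGenerator_sq, smul_mul_assoc, one_mul, smul_smul, mul_right_comm,
        inv_mul_cancel₀ hc', one_mul]
    rw [← hT, e] at h2
    have hcomm : Commute (jumpMatrix c) T := by
      unfold jumpMatrix
      exact ((Commute.one_left T).smul_left _).add_left ((Commute.refl T).smul_left _)
    rw [perssonG, h2.tsum_eq, add_mul, one_mul]
    simp only [Finset.sum_range_succ, Finset.sum_range_zero, Nat.factorial_zero, Nat.factorial_one,
      Nat.cast_one, inv_one, one_smul, pow_zero, pow_one, zero_add]
    rw [mul_assoc, ((hcomm.sub_left ((Commute.one_left T).add_left (Commute.refl T)))).eq,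
      smul_mul_assoc, ← mul_assoc, ← sq, hT, potentialGenerator_sq, smul_mul_assoc, one_mul,
      smul_smul, inv_mul_cancel₀ hc', one_smul]
    abel

lemma J_mul_J : J * J = -1 := by
  ext i j
  fin_cases i <;> fin_cases j <;> simp [J, Matrix.mul_apply]

lemma potentialAtom_mul_conjTranspose_J (q : LocalComplexMeasure) (x : ℝ) :
    potentialAtom q x * J.conjTranspose = potentialGenerator (q.atom x) := by
  ext i j
  fin_cases i <;> fin_cases j <;>
    simp [potentialAtom, potentialGenerator, J, Matrix.mul_apply]

lemma potentialGenerator_mul_J (q : LocalComplexMeasure) (x : ℝ) :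
    potentialGenerator (q.atom x) * J = potentialAtom q x := by
  ext i j
  fin_cases i <;> fin_cases j <;>
    simp [potentialAtom, potentialGenerator, J, Matrix.mul_apply]

lemma J_add_jumpCoeff (q : LocalComplexMeasure) (x : ℝ) :
    J + jumpCoeff q x = jumpMatrix (q.atom x) * J := by
  rw [jumpCoeff, potentialAtom_mul_conjTranspose_J, ← potentialGenerator_mul_J, ← mul_assoc,
    perssonG_mul_self, sub_mul, one_mul, add_sub_cancel]

/-- A symmetric matrix E of determinant 1 satisfies E J E = J. -/
lemma jumpMatrix_mul_J_mul_jumpMatrix (c : ℂ) : jumpMatrix c * J * jumpMatrix c = J := by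
  have h1 := Complex.cosh_sq_sub_sinh_sq (‖c‖ : ℂ)
  have h2 := norm_sq_eq_re_add_im c
  have h3 : (Complex.sinh ‖c‖ / ‖c‖) ^ 2 * ((c.re : ℂ) ^ 2 + (c.im : ℂ) ^ 2) =
      Complex.sinh ‖c‖ ^ 2 := by
    rw [← h2]
    rcases eq_or_ne c 0 with rfl | hc
    · simp
    · have hc' : (‖c‖ : ℂ) ≠ 0 := by simpa using hc
      field_simp
  unfold jumpMatrix
  generalize Complex.sinh ‖c‖ / ‖c‖ = S at *
  generalize Complex.cosh ‖c‖ = C at *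
  ext i j
  fin_cases i <;> fin_cases j <;> simp [potentialGenerator, J, Matrix.mul_apply]
  · ring
  · linear_combination -h1 + h3
  · linear_combination h1 - h3
  · ring

/-- At an atom the integral equation reads (J + g(QJ*)Q) N(x) = J N(x-); this identity says that its
solution is N(x) = exp(QJ*) N(x-). -/
lemma J_add_jumpCoeff_mul_jumpMatrix (q : LocalComplexMeasure) (x : ℝ) :
    (J + jumpCoeff q x) * jumpMatrix (q.atom x) = J := by
  rw [J_add_jumpCoeff, jumpMatrix_mul_J_mul_jumpMatrix]

lemma eq_zero_of_J_add_jumpCoeff_mul {q : LocalComplexMeasure} {x : ℝ}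
    {D : Matrix (Fin 2) (Fin 2) ℂ} (h : (J + jumpCoeff q x) * D = 0) : D = 0 := by
  have h1 : (J + jumpCoeff q x) * (-(jumpMatrix (q.atom x) * J)) = 1 := by
    rw [mul_neg, ← mul_assoc, J_add_jumpCoeff_mul_jumpMatrix, J_mul_J, neg_neg]
  rw [← one_mul D, ← mul_eq_one_comm.1 h1, mul_assoc, h, mul_zero]

/-- The rotation `exp (-θ J)`, the fundamental solution of the free equation. -/
noncomputable def rotation (θ : ℂ) : Matrix (Fin 2) (Fin 2) ℂ :=
  !![Complex.cos θ, Complex.sin θ; -Complex.sin θ, Complex.cos θ]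

@[simp] lemma rotation_zero : rotation 0 = 1 := by
  ext i j
  fin_cases i <;> fin_cases j <;> simp [rotation]

lemma continuous_rotation : Continuous rotation := by
  refine continuous_matrix fun i j => ?_
  fin_cases i <;> fin_cases j <;> simp [rotation] <;> fun_prop

lemma rotation_mul_zero (θ : ℂ) (P : Matrix (Fin 2) (Fin 2) ℂ) (j : Fin 2) :
    (rotation θ * P) 0 j = Complex.cos θ * P 0 j + Complex.sin θ * P 1 j := by
  simp [rotation, Matrix.mul_apply, Fin.sum_univ_two]

lemma rotation_mul_one (θ : ℂ) (P : Matrix (Fin 2) (Fin 2) ℂ) (j : Fin 2) :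
    (rotation θ * P) 1 j = -Complex.sin θ * P 0 j + Complex.cos θ * P 1 j := by
  simp [rotation, Matrix.mul_apply, Fin.sum_univ_two]

lemma J_mul_zero (P : Matrix (Fin 2) (Fin 2) ℂ) (j : Fin 2) : (J * P) 0 j = -P 1 j := by
  simp [J, Matrix.mul_apply, Fin.sum_univ_two]

lemma J_mul_one (P : Matrix (Fin 2) (Fin 2) ℂ) (j : Fin 2) : (J * P) 1 j = P 0 j := by
  simp [J, Matrix.mul_apply, Fin.sum_univ_two]

/-- The matrix function `R(t) = rotation (z t) P` satisfies `J R' = z R`. -/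
lemma hasDerivAt_J_mul_rotation_mul (z : ℂ) (a : ℝ) (P : Matrix (Fin 2) (Fin 2) ℂ) (i j : Fin 2)
    (t : ℝ) :
    HasDerivAt (fun t : ℝ => (J * (rotation (z * ((t - a : ℝ) : ℂ)) * P)) i j)
      (z * (rotation (z * ((t - a : ℝ) : ℂ)) * P) i j) t := by
  have hθ : HasDerivAt (fun t : ℝ => z * ((t - a : ℝ) : ℂ)) z t := by
    simpa using (((hasDerivAt_id t).sub_const a).ofReal_comp).const_mul z
  have hc := (Complex.hasDerivAt_cos (z * ((t - a : ℝ) : ℂ))).comp t hθ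
  have hs := (Complex.hasDerivAt_sin (z * ((t - a : ℝ) : ℂ))).comp t hθ
  simp only [Function.comp_def] at hc hs
  revert i
  rw [Fin.forall_fin_two]
  constructor
  · simp only [J_mul_zero, rotation_mul_zero, rotation_mul_one]
    refine ((hs.neg.mul_const (P 0 j)).add (hc.mul_const (P 1 j))).fun_neg.congr_deriv ?_
    ring
  · simp only [J_mul_one, rotation_mul_zero, rotation_mul_one]
    refine ((hc.mul_const (P 0 j)).add (hs.mul_const (P 1 j))).congr_deriv ?_
    ring

end DiracSchur

/-! ### Uniqueness for the integral equation -/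

namespace DiracSchur

section RightContinuous

variable {f : ℝ → ℂ}

/-- f is the pointwise limit of the step functions f ∘ u n, where u n x is a grid point strictly to
the right of x tending to x. -/
lemma measurable_of_rightContinuous (hf : ∀ x, ContinuousWithinAt f (Ici x) x) :
    Measurable f := by
  set u : ℕ → ℝ → ℝ := fun n x => ((⌊((n : ℝ) + 1) * x⌋ : ℝ) + 1) / ((n : ℝ) + 1) with hu
  have hlt : ∀ n x, x < u n x := fun n x => by
    rw [hu, lt_div_iff₀ (by positivity), mul_comm]
    exact Int.lt_floor_add_one _
  have hle : ∀ n x, u n x ≤ x + 1 / ((n : ℝ) + 1) := fun n x => by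
    have h0 : (0 : ℝ) < n + 1 := by positivity
    simp only [hu]
    rw [add_div, add_le_add_iff_right, div_le_iff₀ h0, mul_comm x]
    exact Int.floor_le _
  have hlim : ∀ x, Tendsto (fun n => u n x) atTop (𝓝[≥] x) := fun x => by
    refine tendsto_nhdsWithin_iff.2 ⟨?_, .of_forall fun n => (hlt n x).le⟩
    refine tendsto_of_tendsto_of_tendsto_of_le_of_le tendsto_const_nhds ?_
      (fun n => (hlt n x).le) fun n => hle n x
    simpa using tendsto_one_div_add_atTop_nhds_zero_nat.const_add x
  refine measurable_of_tendsto_metrizable (f := fun n x => f (u n x)) (fun n => ?_)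
    (tendsto_pi_nhds.2 fun x => (hf x).tendsto.comp (hlim x))
  exact (measurable_from_top (f := fun m : ℤ => f (((m : ℝ) + 1) / ((n : ℝ) + 1)))).comp
    (Int.measurable_floor.comp (measurable_id.const_mul _))

lemma intervalIntegrable_of_rightContinuous (hf : ∀ x, ContinuousWithinAt f (Ici x) x)
    (hb : ∀ L : ℝ, ∃ C : ℝ, ∀ x ∈ Icc (-L) L, ‖f x‖ ≤ C) (a b : ℝ) :
    IntervalIntegrable f volume a b := by
  obtain ⟨C, hC⟩ := hb (max |a| |b|)
  refine (intervalIntegrable_const (c := C)).mono_fun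
    (measurable_of_rightContinuous hf).aestronglyMeasurable ?_
  refine (ae_restrict_mem measurableSet_uIoc).mono fun x hx => ?_
  refine (hC x ?_).trans (Real.le_norm_self C)
  have ha := abs_le.1 (le_max_left |a| |b|)
  have hb := abs_le.1 (le_max_right |a| |b|)
  rcases le_total a b with h | h
  · rw [uIoc_of_le h] at hx
    exact ⟨by linarith [hx.1], by linarith [hx.2]⟩
  · rw [uIoc_of_ge h] at hx
    exact ⟨by linarith [hx.1], by linarith [hx.2]⟩

lemma integral_Icc_eq_intervalIntegral {a b : ℝ} (hab : a ≤ b) :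
    ∫ t in Icc a b, f t = ∫ t in a..b, f t := by
  rw [integral_Icc_eq_integral_Ioc, intervalIntegral.integral_of_le hab]

lemma continuousOn_and_hasDerivWithinAt_integral (hf : ∀ x, ContinuousWithinAt f (Ici x) x)
    (hi : ∀ a b, IntervalIntegrable f volume a b) (a : ℝ) :
    Continuous (fun x => ∫ t in a..x, f t) ∧
      ∀ x, HasDerivWithinAt (fun x => ∫ t in a..x, f t) (f x) (Ici x) x :=
  ⟨intervalIntegral.continuous_primitive hi a, fun x =>
    intervalIntegral.integral_hasDerivWithinAt_right (hi a x)
      (measurable_of_rightContinuous hf).stronglyMeasurable.stronglyMeasurableAtFilter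
      ((hf x).mono Ioi_subset_Ici_self)⟩

/-- Uniqueness for the free integral equation. -/
lemma eq_zero_of_eq_integral {g : ℝ → ℂ} (hf : ∀ x, ContinuousWithinAt f (Ici x) x)
    (hg : ∀ x, ContinuousWithinAt g (Ici x) x) (hfi : ∀ a b, IntervalIntegrable f volume a b)
    (hgi : ∀ a b, IntervalIntegrable g volume a b) {z : ℂ} {a b : ℝ}
    (h1 : ∀ x ∈ Ico a b, f x = z * ∫ t in a..x, g t)
    (h2 : ∀ x ∈ Ico a b, g x = -(z * ∫ t in a..x, f t)) :
    ∀ x ∈ Ico a b, f x = 0 ∧ g x = 0 := by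
  obtain ⟨hF, hF'⟩ := continuousOn_and_hasDerivWithinAt_integral hf hfi a
  obtain ⟨hG, hG'⟩ := continuousOn_and_hasDerivWithinAt_integral hg hgi a
  -- Grönwall for the pair of primitives: in the sup norm its right derivative (f, g) has exactly
  -- ‖z‖ times its norm.
  have h := eq_zero_of_abs_deriv_le_mul_abs_self_of_eq_zero_right (K := ‖z‖) (a := a) (b := b)
    (hF.prodMk hG).continuousOn (fun x _ => (hF' x).prodMk (hG' x)) (by simp) fun x hx => by
      rw [h1 x hx, h2 x hx, Prod.norm_def, Prod.norm_def, norm_neg, norm_mul, norm_mul,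
        mul_max_of_nonneg _ _ (norm_nonneg z), max_comm]
  intro x hx
  have hx0 := h x (Ico_subset_Icc_self hx)
  rw [Prod.mk_eq_zero] at hx0
  rw [h1 x hx, h2 x hx, hx0.1, hx0.2]
  simp

end RightContinuous

section Uniqueness

variable {q : LocalComplexMeasure} {z : ℂ} {N M : ℝ → Matrix (Fin 2) (Fin 2) ℂ}

lemma continuousWithinAt_entry {s : Set ℝ} {x : ℝ} (h : ContinuousWithinAt N s x) (i j : Fin 2) :
    ContinuousWithinAt (fun t => N t i j) s x :=
  ((continuous_id.matrix_elem i j).tendsto (N x)).comp h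

namespace IsFundamentalSolution

lemma intervalIntegrable (hN : IsFundamentalSolution q z N) (i j : Fin 2) (a b : ℝ) :
    IntervalIntegrable (fun t => N t i j) volume a b :=
  intervalIntegrable_of_rightContinuous
    (fun x => continuousWithinAt_entry (hN.rightContinuous x) i j)
    (fun L => (hN.locallyBounded L).imp fun _ hC x hx => hC x hx i j) a b

lemma equation_apply {ℓ : ℝ} (hℓ : 0 < ℓ) (hq : q.SupportedOnLattice ℓ)
    (hN : IsFundamentalSolution q z N) (x : ℝ) (i j : Fin 2) :
    (J * N x) i j + (∑ k ∈ latticeIndices ℓ x, jumpCoeff q (ℓ * k) * N (ℓ * k)) i j -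
      z * ∫ t in Icc 0 x, N t i j = J i j := by
  have h := congrFun₂ (hN.equation x) i j
  rw [potentialIntegral_eq_sum hℓ hq] at h
  simpa using h

/-- The integral equation has at most one solution. -/
lemma eq {ℓ : ℝ} (hℓ : 0 < ℓ) (hq : q.SupportedOnLattice ℓ) (hN : IsFundamentalSolution q z N)
    (hM : IsFundamentalSolution q z M) : N = M := by
  set D : ℝ → Matrix (Fin 2) (Fin 2) ℂ := fun x => N x - M x with hD
  have hDr : ∀ i j x, ContinuousWithinAt (fun t => D t i j) (Ici x) x := fun i j x =>
    (continuousWithinAt_entry (hN.rightContinuous x) i j).sub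
      (continuousWithinAt_entry (hM.rightContinuous x) i j)
  have hDi : ∀ i j a b, IntervalIntegrable (fun t => D t i j) volume a b := fun i j a b =>
    (hN.intervalIntegrable i j a b).sub (hM.intervalIntegrable i j a b)
  have hint : ∀ i j x, ∫ t in Icc 0 x, D t i j =
      (∫ t in Icc 0 x, N t i j) - ∫ t in Icc 0 x, M t i j := fun i j x => by
    rcases le_or_gt 0 x with hx | hx
    · simp only [integral_Icc_eq_intervalIntegral hx]
      exact intervalIntegral.integral_sub (hN.intervalIntegrable i j 0 x)
        (hM.intervalIntegrable i j 0 x)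
    · simp [Icc_eq_empty hx.not_ge]
  have heq : ∀ x i j, (J * D x) i j +
      (∑ k ∈ latticeIndices ℓ x, jumpCoeff q (ℓ * k) * D (ℓ * k)) i j -
      z * ∫ t in Icc 0 x, D t i j = 0 := fun x i j => by
    have h1 := hN.equation_apply hℓ hq x i j
    have h2 := hM.equation_apply hℓ hq x i j
    rw [hint]
    simp only [hD, mul_sub, Finset.sum_sub_distrib, Matrix.sub_apply]
    linear_combination h1 - h2
  -- Induction over lattice cells. At ℓn only the new atom is left, and J + g(QJ*)Q is invertible;
  -- after it the free equation holds up to the next lattice point.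
  have hvan : ∀ n : ℕ, ∀ x < ℓ * n, D x = 0 := by
    intro n
    induction n with
    | zero =>
      intro x hx
      have hx : x < 0 := by simpa using hx
      have h : J * D x = 0 := by
        ext i j
        have := heq x i j
        rw [latticeIndices_of_neg hℓ hx, Icc_eq_empty hx.not_ge] at this
        simpa using this
      rw [← neg_eq_zero, ← neg_one_mul, ← J_mul_J, mul_assoc, h, mul_zero]
    | succ n ih =>
      have h0 : 0 ≤ ℓ * (n : ℝ) := by positivity
      have hlt : ℓ * (n : ℝ) < ℓ * (n + 1 : ℕ) := by
        push_cast
        nlinarith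
      have hsum : ∀ x ∈ Ico (ℓ * (n : ℝ)) (ℓ * (n + 1 : ℕ)),
          ∑ k ∈ latticeIndices ℓ x, jumpCoeff q (ℓ * k) * D (ℓ * k) =
            jumpCoeff q (ℓ * n) * D (ℓ * n) := fun x hx => by
        rw [latticeIndices_eq_range hℓ hx.1 hx.2, Finset.sum_range_succ, add_eq_right]
        refine Finset.sum_eq_zero fun k hk => ?_
        rw [ih, mul_zero]
        have : (k : ℝ) < n := by exact_mod_cast Finset.mem_range.1 hk
        gcongr
      have hI : ∀ x ∈ Ico (ℓ * (n : ℝ)) (ℓ * (n + 1 : ℕ)), ∀ i j,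
          ∫ t in Icc 0 x, D t i j = ∫ t in (ℓ * (n : ℝ))..x, D t i j := fun x hx i j => by
        rw [integral_Icc_eq_intervalIntegral (h0.trans hx.1),
          ← intervalIntegral.integral_add_adjacent_intervals (hDi i j 0 (ℓ * n)) (hDi i j _ x),
          add_eq_right, intervalIntegral.integral_congr_Ioo_of_le h0 (g := fun _ => 0)]
        · simp
        · intro t ht
          simp [ih t ht.2]
      have hn0 : D (ℓ * n) = 0 := by
        refine eq_zero_of_J_add_jumpCoeff_mul (q := q) (x := ℓ * n) ?_
        ext i j
        have := heq (ℓ * n) i j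
        rw [hsum _ ⟨le_rfl, hlt⟩, hI _ ⟨le_rfl, hlt⟩, intervalIntegral.integral_same, mul_zero,
          sub_zero] at this
        rw [add_mul, Matrix.add_apply, this, Matrix.zero_apply]
      have hJ : ∀ x ∈ Ico (ℓ * (n : ℝ)) (ℓ * (n + 1 : ℕ)), ∀ i j,
          (J * D x) i j = z * ∫ t in (ℓ * (n : ℝ))..x, D t i j := fun x hx i j => by
        have := heq x i j
        rw [hsum x hx, hn0, mul_zero, Matrix.zero_apply, add_zero, hI x hx, sub_eq_zero] at this
        exact this
      intro x hx
      rcases lt_or_ge x (ℓ * n) with h | h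
      · exact ih x h
      have hz : ∀ j, D x 0 j = 0 ∧ D x 1 j = 0 := fun j => by
        refine eq_zero_of_eq_integral (z := z) (hDr 0 j) (hDr 1 j) (hDi 0 j) (hDi 1 j)
          (fun y hy => ?_) (fun y hy => ?_) x ⟨h, hx⟩
        · rw [← hJ y hy, J_mul_one]
        · rw [← hJ y hy, J_mul_zero, neg_neg]
      ext i j
      revert i
      rw [Fin.forall_fin_two]
      exact hz j
  funext x
  obtain ⟨n, hn⟩ := exists_nat_gt (x / ℓ)
  rw [div_lt_iff₀' hℓ] at hn
  exact sub_eq_zero.1 (hvan n x hn)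

end IsFundamentalSolution

end Uniqueness

/-! ### The explicit fundamental solution -/

/-- The values at the points `ℓn` of the fundamental solution for `q = ∑ c k δ_{ℓk}`. -/
noncomputable def latticeState (ℓ : ℝ) (z : ℂ) (c : ℕ → ℂ) : ℕ → Matrix (Fin 2) (Fin 2) ℂ
  | 0 => jumpMatrix (c 0)
  | n + 1 => jumpMatrix (c (n + 1)) * (rotation (z * (ℓ : ℂ)) * latticeState ℓ z c n)

/-- The fundamental solution for `q = ∑ c k δ_{ℓk}`. -/
noncomputable def latticeSolution (ℓ : ℝ) (z : ℂ) (c : ℕ → ℂ) (x : ℝ) :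
    Matrix (Fin 2) (Fin 2) ℂ :=
  if x < 0 then 1 else
    rotation (z * ((x - ℓ * (⌊x / ℓ⌋₊ : ℝ) : ℝ) : ℂ)) * latticeState ℓ z c ⌊x / ℓ⌋₊

section Existence

variable {ℓ : ℝ} {z : ℂ} {c : ℕ → ℂ}

lemma exists_nat_lattice_interval (hℓ : 0 < ℓ) {x : ℝ} (hx : 0 ≤ x) :
    ∃ n : ℕ, x ∈ Ico (ℓ * (n : ℝ)) (ℓ * (n + 1 : ℕ)) := by
  refine ⟨⌊x / ℓ⌋₊, ?_, ?_⟩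
  · rw [← le_div_iff₀' hℓ]
    exact Nat.floor_le (by positivity)
  · rw [← div_lt_iff₀' hℓ]
    exact_mod_cast Nat.lt_floor_add_one (x / ℓ)

lemma latticeSolution_of_neg {x : ℝ} (hx : x < 0) : latticeSolution ℓ z c x = 1 := if_pos hx

lemma latticeSolution_eq (hℓ : 0 < ℓ) {n : ℕ} {x : ℝ}
    (hx : x ∈ Ico (ℓ * (n : ℝ)) (ℓ * (n + 1 : ℕ))) :
    latticeSolution ℓ z c x =
      rotation (z * ((x - ℓ * (n : ℝ) : ℝ) : ℂ)) * latticeState ℓ z c n := by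
  have h0 : 0 ≤ x := le_trans (by positivity) hx.1
  have hn : ⌊x / ℓ⌋₊ = n := by
    rw [Nat.floor_eq_iff (by positivity), le_div_iff₀' hℓ, div_lt_iff₀' hℓ]
    exact_mod_cast hx
  rw [latticeSolution, if_neg h0.not_gt, hn]

lemma latticeSolution_natCast (hℓ : 0 < ℓ) (n : ℕ) :
    latticeSolution ℓ z c (ℓ * n) = latticeState ℓ z c n := by
  rw [latticeSolution_eq hℓ (n := n) ⟨le_rfl, by push_cast; nlinarith⟩]
  simp

lemma continuous_rotation_mul (z : ℂ) (a : ℝ) (P : Matrix (Fin 2) (Fin 2) ℂ) :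
    Continuous fun x : ℝ => rotation (z * ((x - a : ℝ) : ℂ)) * P :=
  (continuous_rotation.comp (by fun_prop)).matrix_mul continuous_const

lemma continuousWithinAt_latticeSolution (hℓ : 0 < ℓ) (x : ℝ) :
    ContinuousWithinAt (latticeSolution ℓ z c) (Ici x) x := by
  rcases lt_or_ge x 0 with hx | hx
  · have h : ContinuousAt (latticeSolution ℓ z c) x :=
      continuousAt_const.congr (f := fun _ => 1) <| by
        filter_upwards [Iio_mem_nhds hx] with y hy
        exact (latticeSolution_of_neg hy).symm
    exact h.continuousWithinAt
  · obtain ⟨n, hn⟩ := exists_nat_lattice_interval hℓ hx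
    refine ((continuous_rotation_mul z (ℓ * n)
      (latticeState ℓ z c n)).continuousWithinAt).congr_of_eventuallyEq ?_
      (latticeSolution_eq hℓ hn)
    filter_upwards [self_mem_nhdsWithin, nhdsWithin_le_nhds (Iio_mem_nhds hn.2)] with y hy1 hy2
    exact latticeSolution_eq hℓ ⟨hn.1.trans hy1, hy2⟩

lemma exists_bound_latticeSolution (hℓ : 0 < ℓ) (n : ℕ) :
    ∃ C : ℝ, ∀ x < ℓ * n, ∀ i j, ‖latticeSolution ℓ z c x i j‖ ≤ C := by
  induction n with
  | zero =>
    refine ⟨1, fun x hx i j => ?_⟩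
    rw [latticeSolution_of_neg (by simpa using hx)]
    fin_cases i <;> fin_cases j <;> simp
  | succ n ih =>
    obtain ⟨C, hC⟩ := ih
    set g : ℝ → ℝ := fun x => ∑ i, ∑ j,
      ‖(rotation (z * ((x - ℓ * (n : ℝ) : ℝ) : ℂ)) * latticeState ℓ z c n) i j‖ with hg
    have hgc : Continuous g := continuous_finsetSum _ fun i _ => continuous_finsetSum _ fun j _ =>
      ((continuous_rotation_mul z (ℓ * n) (latticeState ℓ z c n)).matrix_elem i j).norm
    obtain ⟨C', hC'⟩ := (isCompact_Icc (a := ℓ * (n : ℝ)) (b := ℓ * (n + 1 : ℕ))).bddAbove_image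
      hgc.continuousOn
    refine ⟨max C C', fun x hx i j => ?_⟩
    rcases lt_or_ge x (ℓ * n) with h | h
    · exact (hC x h i j).trans (le_max_left _ _)
    · refine le_trans ?_ ((hC' (mem_image_of_mem g ⟨h, hx.le⟩)).trans (le_max_right _ _))
      rw [latticeSolution_eq hℓ ⟨h, hx⟩, hg]
      refine le_trans ?_ (Finset.single_le_sum (fun i _ => Finset.sum_nonneg fun j _ =>
        norm_nonneg _) (Finset.mem_univ i))
      exact Finset.single_le_sum (f := fun j => ‖(rotation (z * ((x - ℓ * (n : ℝ) : ℝ) : ℂ)) *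
        latticeState ℓ z c n) i j‖) (fun j _ => norm_nonneg _) (Finset.mem_univ j)

lemma exists_bound_latticeSolution_Icc (hℓ : 0 < ℓ) (L : ℝ) :
    ∃ C : ℝ, ∀ x ∈ Icc (-L) L, ∀ i j, ‖latticeSolution ℓ z c x i j‖ ≤ C := by
  obtain ⟨n, hn⟩ := exists_nat_gt (L / ℓ)
  rw [div_lt_iff₀' hℓ] at hn
  exact (exists_bound_latticeSolution hℓ n).imp fun C hC x hx => hC x (hx.2.trans_lt hn)

lemma intervalIntegrable_latticeSolution (hℓ : 0 < ℓ) (i j : Fin 2) (a b : ℝ) :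
    IntervalIntegrable (fun t => latticeSolution ℓ z c t i j) volume a b :=
  intervalIntegrable_of_rightContinuous
    (fun x => continuousWithinAt_entry (continuousWithinAt_latticeSolution hℓ x) i j)
    (fun L => (exists_bound_latticeSolution_Icc hℓ L).imp fun _ hC x hx => hC x hx i j) a b

lemma integral_latticeSolution (hℓ : 0 < ℓ) {n : ℕ} {s : ℝ}
    (hs : s ∈ Icc (ℓ * (n : ℝ)) (ℓ * (n + 1 : ℕ))) (i j : Fin 2) :
    z * ∫ t in (ℓ * (n : ℝ))..s, latticeSolution ℓ z c t i j =
      (J * (rotation (z * ((s - ℓ * (n : ℝ) : ℝ) : ℂ)) * latticeState ℓ z c n)) i j -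
        (J * latticeState ℓ z c n) i j := by
  rw [intervalIntegral.integral_congr_Ioo_of_le hs.1 (g := fun t =>
    (rotation (z * ((t - ℓ * (n : ℝ) : ℝ) : ℂ)) * latticeState ℓ z c n) i j),
    ← intervalIntegral.integral_const_mul, intervalIntegral.integral_eq_sub_of_hasDerivAt
      (fun t _ => hasDerivAt_J_mul_rotation_mul z (ℓ * n) (latticeState ℓ z c n) i j t)]
  · simp
  · exact (((continuous_rotation_mul z (ℓ * n)
      (latticeState ℓ z c n)).matrix_elem i j).const_mul z).intervalIntegrable _ _
  · intro t ht
    simp only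
    rw [latticeSolution_eq hℓ ⟨ht.1.le, ht.2.trans_le hs.2⟩]

variable {q : LocalComplexMeasure}

/-- The closed cell matters: at s = ℓ(n + 1) the rotation formula gives the left limit, from which
the next jump starts in the induction. -/
lemma latticeState_equation (hℓ : 0 < ℓ) (n : ℕ) {s : ℝ}
    (hs : s ∈ Icc (ℓ * (n : ℝ)) (ℓ * (n + 1 : ℕ))) (i j : Fin 2) :
    (J * (rotation (z * ((s - ℓ * (n : ℝ) : ℝ) : ℂ)) *
        latticeState ℓ z (fun k => q.atom (ℓ * k)) n)) i j +
      (∑ k ∈ Finset.range (n + 1), jumpCoeff q (ℓ * k) *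
        latticeState ℓ z (fun k => q.atom (ℓ * k)) k) i j -
      z * ∫ t in (0 : ℝ)..s, latticeSolution ℓ z (fun k => q.atom (ℓ * k)) t i j = J i j := by
  induction n generalizing s with
  | zero =>
    have h1 := integral_latticeSolution (z := z) (c := fun k => q.atom (ℓ * k)) hℓ hs i j
    have h2 := congrFun₂ (J_add_jumpCoeff_mul_jumpMatrix q (ℓ * (0 : ℕ))) i j
    rw [add_mul, Matrix.add_apply] at h2
    have e : ℓ * ((0 : ℕ) : ℝ) = 0 := by simp
    rw [zero_add, Finset.sum_range_one]
    simp only [latticeState] at h1 h2 ⊢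
    simp only [e] at h1 h2 ⊢
    linear_combination h2 - h1
  | succ n ih =>
    have hn : ℓ * (n : ℝ) ≤ ℓ * (n + 1 : ℕ) := by push_cast; nlinarith
    have h0 := ih ⟨hn, le_rfl⟩
    have h1 := integral_latticeSolution (z := z) (c := fun k => q.atom (ℓ * k)) hℓ hs i j
    have h2 : ((J + jumpCoeff q (ℓ * (n + 1 : ℕ))) *
        latticeState ℓ z (fun k => q.atom (ℓ * k)) (n + 1)) i j =
        (J * (rotation (z * (ℓ : ℂ)) * latticeState ℓ z (fun k => q.atom (ℓ * k)) n)) i j := by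
      rw [latticeState, ← mul_assoc, J_add_jumpCoeff_mul_jumpMatrix]
    rw [add_mul, Matrix.add_apply] at h2
    have h3 := intervalIntegral.integral_add_adjacent_intervals
      (intervalIntegrable_latticeSolution (z := z) (c := fun k => q.atom (ℓ * k)) hℓ i j 0
        (ℓ * (n + 1 : ℕ))) (intervalIntegrable_latticeSolution hℓ i j _ s)
    have e : ℓ * ((n + 1 : ℕ) : ℝ) - ℓ * n = ℓ := by push_cast; ring
    rw [e] at h0
    rw [Finset.sum_range_succ, Matrix.add_apply, ← h3]
    linear_combination h0 - h1 + h2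

/-- The integral equation with a potential on the half-lattice has a solution. -/
lemma isFundamentalSolution_latticeSolution (hℓ : 0 < ℓ) (hq : q.SupportedOnLattice ℓ) :
    IsFundamentalSolution q z (latticeSolution ℓ z fun k => q.atom (ℓ * k)) where
  rightContinuous := continuousWithinAt_latticeSolution hℓ
  locallyBounded := exists_bound_latticeSolution_Icc hℓ
  equation x := by
    rw [potentialIntegral_eq_sum hℓ hq]
    rcases lt_or_ge x 0 with hx | hx
    · rw [latticeIndices_of_neg hℓ hx, latticeSolution_of_neg hx, Icc_eq_empty hx.not_ge]
      ext i j
      simp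
    · obtain ⟨n, hn⟩ := exists_nat_lattice_interval hℓ hx
      ext i j
      have h := latticeState_equation (z := z) (q := q) hℓ n (Ico_subset_Icc_self hn) i j
      rw [latticeIndices_eq_range hℓ hn.1 hn.2]
      simp only [latticeSolution_natCast hℓ, Matrix.sub_apply, Matrix.add_apply, Matrix.smul_apply,
        Matrix.of_apply, smul_eq_mul, integral_Icc_eq_intervalIntegral hx]
      rw [latticeSolution_eq hℓ hn]
      exact h

/-- Uniqueness identifies the solution chosen by `Classical.epsilon` with the explicit one. -/
lemma fundamentalSolution_eq (hℓ : 0 < ℓ) (hq : q.SupportedOnLattice ℓ) :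
    fundamentalSolution q z = latticeSolution ℓ z fun k => q.atom (ℓ * k) :=
  IsFundamentalSolution.eq hℓ hq
    (Classical.epsilon_spec ⟨_, isFundamentalSolution_latticeSolution hℓ hq⟩)
    (isFundamentalSolution_latticeSolution hℓ hq)

lemma existsUnique_isFundamentalSolution (hℓ : 0 < ℓ) (hq : q.SupportedOnLattice ℓ) :
    ∃! N, IsFundamentalSolution q z N :=
  ⟨_, isFundamentalSolution_latticeSolution hℓ hq, fun _ hN =>
    hN.eq hℓ hq (isFundamentalSolution_latticeSolution hℓ hq)⟩

end Existence

end DiracSchur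

/-! ### The Cayley ratio and the parameter of an atom -/

namespace DiracSchur

open scoped ComplexConjugate

/-- The inverse of `ϰ`: the Schur parameter of a point mass. -/
noncomputable def schurParam (c : ℂ) : ℂ := conj c / ‖c‖ * (Real.tanh ‖c‖ : ℂ)

lemma norm_conj_div_mul {c : ℂ} (hc : c ≠ 0) {t : ℝ} (ht : 0 ≤ t) :
    ‖conj c / ‖c‖ * (t : ℂ)‖ = t := by
  have : ‖c‖ ≠ 0 := by simpa using hc
  simp [this, abs_of_nonneg ht]

lemma conj_conj_div_mul (c : ℂ) {t : ℝ} (ht : 0 < t) :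
    conj (conj c / ‖c‖ * (t : ℂ)) / (t : ℂ) = c / ‖c‖ := by
  have : (t : ℂ) ≠ 0 := by exact_mod_cast ht.ne'
  simp [this]

lemma tanh_norm_nonneg (c : ℂ) : 0 ≤ Real.tanh ‖c‖ := by
  rw [Real.tanh_eq_sinh_div_cosh]
  exact div_nonneg (Real.sinh_nonneg_iff.2 (norm_nonneg c)) (Real.cosh_pos _).le

lemma norm_schurParam_lt_one (c : ℂ) : ‖schurParam c‖ < 1 := by
  rcases eq_or_ne c 0 with rfl | hc
  · simp [schurParam]
  · rw [schurParam, norm_conj_div_mul hc (tanh_norm_nonneg c)]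
    exact Real.tanh_lt_one _

lemma kappa_eq_artanh {w : ℂ} (hw : ‖w‖ < 1) :
    kappa w = conj w / ‖w‖ * (Real.artanh ‖w‖ : ℂ) := by
  rw [kappa, Real.artanh_eq_half_log ⟨by linarith [norm_nonneg w], hw.le⟩]
  push_cast
  ring

/-- Both maps have the form v ↦ (conj v / |v|) h(|v|), with h = tanh and h = artanh, and the two
conjugations cancel. -/
lemma kappa_schurParam (c : ℂ) : kappa (schurParam c) = c := by
  rw [kappa_eq_artanh (norm_schurParam_lt_one c)]
  rcases eq_or_ne c 0 with rfl | hc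
  · simp [schurParam]
  · have h0 : 0 < Real.tanh ‖c‖ := by
      rw [Real.tanh_eq_sinh_div_cosh]
      exact div_pos (Real.sinh_pos_iff.2 (norm_pos_iff.2 hc)) (Real.cosh_pos _)
    have hc' : (‖c‖ : ℂ) ≠ 0 := by simpa using hc
    rw [schurParam, norm_conj_div_mul hc h0.le, conj_conj_div_mul c h0, Real.artanh_tanh,
      div_mul_cancel₀ _ hc']

lemma schurParam_kappa {w : ℂ} (hw : ‖w‖ < 1) : schurParam (kappa w) = w := by
  rw [kappa_eq_artanh hw]
  rcases eq_or_ne w 0 with rfl | h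
  · simp [schurParam]
  · have h1 : 0 < ‖w‖ := norm_pos_iff.2 h
    have h0 : 0 < Real.artanh ‖w‖ := Real.artanh_pos ⟨h1, hw⟩
    have hc' : (‖w‖ : ℂ) ≠ 0 := by simpa using h
    rw [schurParam, norm_conj_div_mul h h0.le, conj_conj_div_mul w h0,
      Real.tanh_artanh ⟨by linarith, hw⟩, div_mul_cancel₀ _ hc']

/-- The quotient `(r 1 - i r 0) / (r 1 + i r 0)` is defined and equal to `τ`. -/
def HasCayleyRatio (τ : ℂ) (r : Fin 2 → ℂ) : Prop :=
  r 1 + Complex.I * r 0 ≠ 0 ∧ r 1 - Complex.I * r 0 = τ * (r 1 + Complex.I * r 0)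

namespace HasCayleyRatio

variable {τ : ℂ} {r : Fin 2 → ℂ}

/-- In the coordinates α = r₁ - i r₀, β = r₁ + i r₀ the jump is α ↦ cosh |c| (α + wβ), β ↦ cosh |c|
(β + conj w α). -/
lemma vecMul_jumpMatrix (h : HasCayleyRatio τ r) (hτ : ‖τ‖ ≤ 1) (c : ℂ) :
    HasCayleyRatio (mob (schurParam c) τ) (Matrix.vecMul r (jumpMatrix c)) := by
  obtain ⟨h1, h2⟩ := h
  have hne := one_add_conj_mul_ne_zero (norm_schurParam_lt_one c) hτ
  have hC : Complex.cosh ‖c‖ ≠ 0 := by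
    rw [← Complex.ofReal_cosh]
    exact_mod_cast (Real.cosh_pos _).ne'
  have hw : Complex.cosh ‖c‖ * schurParam c = Complex.sinh ‖c‖ / ‖c‖ * conj c := by
    rw [schurParam, Real.tanh_eq_sinh_div_cosh]
    push_cast
    field_simp
  have hw' : Complex.cosh ‖c‖ * conj (schurParam c) = Complex.sinh ‖c‖ / ‖c‖ * c := by
    have := congrArg conj hw
    rwa [map_mul, map_mul, map_div₀, Complex.conj_conj, Complex.conj_ofReal, ← Complex.ofReal_cosh,
      ← Complex.ofReal_sinh, Complex.conj_ofReal, Complex.conj_ofReal, Complex.ofReal_cosh,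
      Complex.ofReal_sinh] at this
  have e0 : Matrix.vecMul r (jumpMatrix c) 0 =
      Complex.cosh ‖c‖ * r 0 + Complex.sinh ‖c‖ / ‖c‖ * (-(c.re : ℂ) * r 0 + c.im * r 1) := by
    simp [Matrix.vecMul, dotProduct, Fin.sum_univ_two, jumpMatrix, potentialGenerator]
    ring
  have e1 : Matrix.vecMul r (jumpMatrix c) 1 =
      Complex.cosh ‖c‖ * r 1 + Complex.sinh ‖c‖ / ‖c‖ * ((c.im : ℂ) * r 0 + c.re * r 1) := by
    simp [Matrix.vecMul, dotProduct, Fin.sum_univ_two, jumpMatrix, potentialGenerator]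
    ring
  have hc : c = c.re + c.im * Complex.I := (Complex.re_add_im c).symm
  have hcc : conj c = c.re - c.im * Complex.I := by
    apply Complex.ext <;> simp
  have hβ : Matrix.vecMul r (jumpMatrix c) 1 + Complex.I * Matrix.vecMul r (jumpMatrix c) 0 =
      Complex.cosh ‖c‖ * (r 1 + Complex.I * r 0) * (1 + conj (schurParam c) * τ) := by
    have : Complex.cosh ‖c‖ * (r 1 + Complex.I * r 0) * (1 + conj (schurParam c) * τ) =
        Complex.cosh ‖c‖ * (r 1 + Complex.I * r 0) + Complex.cosh ‖c‖ * conj (schurParam c) *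
          (τ * (r 1 + Complex.I * r 0)) := by ring
    rw [this, ← h2, hw', e0, e1]
    conv_rhs => rw [mul_assoc (Complex.sinh ‖c‖ / ‖c‖) c]; arg 2; arg 2; rw [hc]
    linear_combination (Complex.sinh ‖c‖ / ‖c‖) * c.im * r 0 * Complex.I_sq
  have hα : Matrix.vecMul r (jumpMatrix c) 1 - Complex.I * Matrix.vecMul r (jumpMatrix c) 0 =
      Complex.cosh ‖c‖ * (r 1 + Complex.I * r 0) * (τ + schurParam c) := by
    have : Complex.cosh ‖c‖ * (r 1 + Complex.I * r 0) * (τ + schurParam c) =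
        Complex.cosh ‖c‖ * (τ * (r 1 + Complex.I * r 0)) + Complex.cosh ‖c‖ * schurParam c *
          (r 1 + Complex.I * r 0) := by ring
    rw [this, ← h2, hw, e0, e1, hcc]
    linear_combination (Complex.sinh ‖c‖ / ‖c‖) * c.im * r 0 * Complex.I_sq
  refine ⟨?_, ?_⟩
  · rw [hβ]
    exact mul_ne_zero (mul_ne_zero hC h1) hne
  · rw [hα, hβ, mul_left_comm, mob, div_mul_cancel₀ _ hne]

/-- The coordinates r₁ ∓ i r₀ diagonalise the rotation, with multipliers e^{±iθ}. -/
lemma vecMul_rotation (h : HasCayleyRatio τ r) (θ : ℂ) :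
    HasCayleyRatio (Complex.exp (2 * Complex.I * θ) * τ) (Matrix.vecMul r (rotation θ)) := by
  obtain ⟨h1, h2⟩ := h
  have e0 : Matrix.vecMul r (rotation θ) 0 = Complex.cos θ * r 0 - Complex.sin θ * r 1 := by
    simp [Matrix.vecMul, dotProduct, Fin.sum_univ_two, rotation]
    ring
  have e1 : Matrix.vecMul r (rotation θ) 1 = Complex.sin θ * r 0 + Complex.cos θ * r 1 := by
    simp [Matrix.vecMul, dotProduct, Fin.sum_univ_two, rotation]
    ring
  have hβ : Matrix.vecMul r (rotation θ) 1 + Complex.I * Matrix.vecMul r (rotation θ) 0 =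
      Complex.exp (-θ * Complex.I) * (r 1 + Complex.I * r 0) := by
    rw [Complex.exp_mul_I, Complex.cos_neg, Complex.sin_neg, e0, e1]
    linear_combination Complex.sin θ * r 0 * Complex.I_sq
  have hα : Matrix.vecMul r (rotation θ) 1 - Complex.I * Matrix.vecMul r (rotation θ) 0 =
      Complex.exp (θ * Complex.I) * (r 1 - Complex.I * r 0) := by
    rw [Complex.exp_mul_I, e0, e1]
    linear_combination Complex.sin θ * r 0 * Complex.I_sq
  refine ⟨?_, ?_⟩
  · rw [hβ]
    exact mul_ne_zero (Complex.exp_ne_zero _) h1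
  · rw [hα, hβ, h2, show θ * Complex.I = 2 * Complex.I * θ + -θ * Complex.I by ring,
      Complex.exp_add]
    ring

/-- On rows the leftmost factor acts first, so the latest atom is the innermost parameter; hence τ
and r vary in the induction. -/
lemma vecMul_latticeState (h : HasCayleyRatio τ r) (hτ : ‖τ‖ ≤ 1) {ℓ : ℝ} {z : ℂ} (c : ℕ → ℂ)
    (hz : ‖Complex.exp (2 * Complex.I * (z * ℓ))‖ < 1) (n : ℕ) :
    HasCayleyRatio (schurApprox (fun k => schurParam (c k)) (Complex.exp (2 * Complex.I * (z * ℓ)))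
      n τ) (Matrix.vecMul r (latticeState ℓ z c n)) := by
  induction n generalizing τ r with
  | zero => exact h.vecMul_jumpMatrix hτ (c 0)
  | succ n ih =>
    rw [latticeState, ← Matrix.vecMul_vecMul, ← Matrix.vecMul_vecMul]
    exact ih ((h.vecMul_jumpMatrix hτ (c (n + 1))).vecMul_rotation _)
      (norm_lt_one_of_mul hz (norm_mob_le_one (norm_schurParam_lt_one _) hτ)).le

/-- For τ = 1 one has r 0 = 0, and both sides are 0 by the convention for division by zero. -/
lemma div_eq (h : HasCayleyRatio τ r) : r 1 / r 0 = Complex.I * (1 + τ) / (1 - τ) := by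
  obtain ⟨h1, h2⟩ := h
  set β := r 1 + Complex.I * r 0 with hβ
  have e1 : r 1 = β / 2 * (1 + τ) := by linear_combination h2 / 2 - hβ / 2
  have e0 : r 0 = β / 2 * (-Complex.I * (1 - τ)) := by
    linear_combination Complex.I * h2 / 2 + Complex.I * hβ / 2 + r 0 * Complex.I_sq
  rw [e0, e1, mul_div_mul_left _ _ (by simpa using h1), div_mul_eq_div_div, div_neg, Complex.div_I]
  ring

end HasCayleyRatio

/-! ### The Weyl and Schur functions of a lattice potential -/

/-- The variable `e^{2iℓz}` of the unit disk. -/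
noncomputable def nome (ℓ : ℝ) (z : ℂ) : ℂ := Complex.exp (2 * Complex.I * (ℓ : ℂ) * z)

lemma norm_exp_two_mul_I_mul (a : ℝ) (z : ℂ) :
    ‖Complex.exp (2 * Complex.I * (a : ℂ) * z)‖ = Real.exp (-(2 * a * z.im)) := by
  rw [Complex.norm_exp]
  congr 1
  simp [mul_assoc]

lemma norm_nome_lt_one {ℓ : ℝ} (hℓ : 0 < ℓ) (z : ℍ) : ‖nome ℓ z‖ < 1 := by
  rw [nome, norm_exp_two_mul_I_mul, Real.exp_lt_one_iff]
  have := z.im_pos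
  rw [UpperHalfPlane.coe_im, neg_lt_zero]
  positivity

section Direct

variable {ℓ : ℝ} {q : LocalComplexMeasure}

lemma norm_schurParam_atom_lt_one (ℓ : ℝ) (q : LocalComplexMeasure) (k : ℕ) :
    ‖schurParam (q.atom (ℓ * k))‖ < 1 := norm_schurParam_lt_one _

lemma exists_quotient_eq (hℓ : 0 < ℓ) (hq : q.SupportedOnLattice ℓ) (z : ℍ) {x : ℝ} {n : ℕ}
    (hx : x ∈ Ico (ℓ * (n : ℝ)) (ℓ * (n + 1 : ℕ))) :
    ∃ τ : ℂ, ‖τ‖ ≤ 1 ∧ fundamentalSolution q z x 1 1 / fundamentalSolution q z x 1 0 =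
      Complex.I * (1 + schurApprox (fun k => schurParam (q.atom (ℓ * k))) (nome ℓ z) n τ) /
        (1 - schurApprox (fun k => schurParam (q.atom (ℓ * k))) (nome ℓ z) n τ) := by
  have hnome : nome ℓ z = Complex.exp (2 * Complex.I * ((z : ℂ) * ℓ)) := by
    rw [nome]
    ring_nf
  -- The row (0, 1) selects the second row of N; its ratio 1 is then multiplied by e^{2iz(x - ℓn)},
  -- of modulus at most 1.
  have h1 : HasCayleyRatio 1 ![0, 1] := ⟨by simp, by simp⟩
  have h2 := h1.vecMul_rotation ((z : ℂ) * ((x - ℓ * (n : ℝ) : ℝ) : ℂ))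
  rw [mul_one] at h2
  have hτ : ‖Complex.exp (2 * Complex.I * ((z : ℂ) * ((x - ℓ * (n : ℝ) : ℝ) : ℂ)))‖ ≤ 1 := by
    rw [mul_comm (z : ℂ), ← mul_assoc, norm_exp_two_mul_I_mul, Real.exp_le_one_iff]
    have h3 := z.im_pos
    have h4 : 0 ≤ x - ℓ * n := sub_nonneg.2 hx.1
    rw [UpperHalfPlane.coe_im, neg_nonpos]
    positivity
  have h3 := h2.vecMul_latticeState hτ (ℓ := ℓ) (fun k => q.atom (ℓ * k))
    (hnome ▸ norm_nome_lt_one hℓ z) n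
  rw [Matrix.vecMul_vecMul, ← latticeSolution_eq hℓ hx, ← fundamentalSolution_eq hℓ hq,
    ← hnome] at h3
  refine ⟨_, hτ, ?_⟩
  rw [← h3.div_eq]
  simp [Matrix.vecMul, dotProduct, Fin.sum_univ_two]

lemma tendsto_quotient (hℓ : 0 < ℓ) (hq : q.SupportedOnLattice ℓ) (z : ℍ) :
    Tendsto (fun x : ℝ => fundamentalSolution q z x 1 1 / fundamentalSolution q z x 1 0) atTop
      (𝓝 (Complex.I * (1 + schurLimit (fun k => schurParam (q.atom (ℓ * k))) (nome ℓ z)) /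
        (1 - schurLimit (fun k => schurParam (q.atom (ℓ * k))) (nome ℓ z)))) := by
  have hw := norm_schurParam_atom_lt_one ℓ q
  have hζ := norm_nome_lt_one hℓ z
  -- The tail varies with x inside a cell, but the error bound is uniform in the tail, so x may tend
  -- to infinity through the reals.
  have key : ∀ x : ℝ, ∃ f : ℂ, 0 ≤ x →
      (‖f - schurLimit (fun k => schurParam (q.atom (ℓ * k))) (nome ℓ z)‖ ≤
        2 * contractionRate ‖nome ℓ z‖ ^ ⌊x / ℓ⌋₊ ∧
      fundamentalSolution q z x 1 1 / fundamentalSolution q z x 1 0 =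
        Complex.I * (1 + f) / (1 - f)) := fun x => by
    rcases lt_or_ge x 0 with hx | hx
    · exact ⟨0, fun h => absurd h hx.not_ge⟩
    · have hn : x ∈ Ico (ℓ * (⌊x / ℓ⌋₊ : ℝ)) (ℓ * (⌊x / ℓ⌋₊ + 1 : ℕ)) := by
        rw [mem_Ico, ← le_div_iff₀' hℓ, ← div_lt_iff₀' hℓ]
        exact ⟨Nat.floor_le (by positivity), by exact_mod_cast Nat.lt_floor_add_one (x / ℓ)⟩
      obtain ⟨τ, hτ, h⟩ := exists_quotient_eq hℓ hq z hn
      exact ⟨_, fun _ => ⟨norm_schurApprox_sub_schurLimit_le hw hζ _ hτ, h⟩⟩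
  choose f hf using key
  have hlim : Tendsto f atTop
      (𝓝 (schurLimit (fun k => schurParam (q.atom (ℓ * k))) (nome ℓ z))) := by
    rw [tendsto_iff_norm_sub_tendsto_zero]
    refine tendsto_of_tendsto_of_tendsto_of_le_of_le' tendsto_const_nhds
      ((tendsto_two_mul_contractionRate_pow hζ).comp
        (tendsto_nat_floor_atTop.comp (tendsto_id.atTop_div_const hℓ)))
      (.of_forall fun x => norm_nonneg _) ?_
    filter_upwards [eventually_ge_atTop 0] with x hx
    exact (hf x hx).1
  have hne : 1 - schurLimit (fun k => schurParam (q.atom (ℓ * k))) (nome ℓ z) ≠ 0 := fun h => by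
    have := norm_schurLimit_lt_one hw hζ
    rw [← sub_eq_zero.1 h, norm_one] at this
    exact this.false
  refine (((hlim.const_add 1).const_mul Complex.I).div (hlim.const_sub 1) hne).congr' ?_
  filter_upwards [eventually_ge_atTop 0] with x hx
  exact (hf x hx).2.symm

lemma weylFunction_eq (hℓ : 0 < ℓ) (hq : q.SupportedOnLattice ℓ) (z : ℍ) :
    weylFunction q z =
      Complex.I * (1 + schurLimit (fun k => schurParam (q.atom (ℓ * k))) (nome ℓ z)) /
        (1 - schurLimit (fun k => schurParam (q.atom (ℓ * k))) (nome ℓ z)) :=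
  (tendsto_quotient hℓ hq z).limUnder_eq

lemma schurFunction_eq (hℓ : 0 < ℓ) (hq : q.SupportedOnLattice ℓ) (z : ℍ) :
    schurFunction q z = schurLimit (fun k => schurParam (q.atom (ℓ * k))) (nome ℓ z) := by
  have h := norm_schurLimit_lt_one (norm_schurParam_atom_lt_one ℓ q) (norm_nome_lt_one hℓ z)
  rw [schurFunction, weylFunction_eq hℓ hq z]
  generalize schurLimit (fun k => schurParam (q.atom (ℓ * k))) (nome ℓ z) = f at *
  have hne : 1 - f ≠ 0 := fun h0 => by
    rw [← sub_eq_zero.1 h0, norm_one] at h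
    exact h.false
  have e1 : Complex.I * (1 + f) / (1 - f) - Complex.I = 2 * Complex.I / (1 - f) * f := by
    field_simp
    ring
  have e2 : Complex.I * (1 + f) / (1 - f) + Complex.I = 2 * Complex.I / (1 - f) := by
    field_simp
    ring
  rw [e1, e2, mul_div_cancel_left₀]
  exact div_ne_zero (by simp) hne

end Direct

/-! ### Recurrence coefficients in the upper half-plane -/

section UpperHalfPlaneChain

variable {ℓ : ℝ} {w : ℕ → ℂ} {F : ℕ → ℂ → ℂ} {f : ℍ → ℂ}

/-- On the imaginary axis e^{2iℓz} = e^{-2ℓy} → 0, so the value at infinity is the value of G at the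
centre of the disk. -/
lemma tendsto_alongImaginaryAxis (hℓ : 0 < ℓ) {G : ℂ → ℂ} (hG : ContinuousAt G 0) {g : ℍ → ℂ}
    (hg : ∀ z : ℍ, g z = G (nome ℓ z)) : Tendsto (alongImaginaryAxis g) atTop (𝓝 (G 0)) := by
  have h0 : Tendsto (fun y : ℝ => nome ℓ (Complex.I * y)) atTop (𝓝 0) := by
    rw [tendsto_zero_iff_norm_tendsto_zero]
    simp only [nome, norm_exp_two_mul_I_mul, Complex.mul_im, Complex.I_re, Complex.I_im,
      Complex.ofReal_re, Complex.ofReal_im, zero_mul, one_mul, zero_add]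
    exact Real.tendsto_exp_neg_atTop_nhds_zero.comp (tendsto_id.const_mul_atTop (by positivity))
  refine (hG.tendsto.comp h0).congr' ?_
  filter_upwards [eventually_gt_atTop 0] with y hy
  rw [alongImaginaryAxis, hg, Function.comp_apply,
    UpperHalfPlane.ofComplex_apply_of_im_pos (by simpa using hy)]

namespace IsSchurChain

lemma continuousAt_zero (h : IsSchurChain w F) (k : ℕ) : ContinuousAt (F k) 0 :=
  ((h.differentiableOn k 0 (by simp)).differentiableAt
    (Metric.ball_mem_nhds _ one_pos)).continuousAt

lemma schurIterate_eq (h : IsSchurChain w F) (hℓ : 0 < ℓ) (hf : ∀ z : ℍ, f z = F 0 (nome ℓ z))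
    (k : ℕ) (z : ℍ) : schurIterate ℓ f k z = F k (nome ℓ z) := by
  induction k generalizing z with
  | zero => exact hf z
  | succ k ih =>
    have hv : valueAtInfinity (schurIterate ℓ f k) = w k := by
      rw [← h.apply_zero k]
      exact (tendsto_alongImaginaryAxis hℓ (h.continuousAt_zero k) ih).limUnder_eq
    have hζ := norm_nome_lt_one hℓ z
    simp only [schurIterate]
    rw [hv, ih, h.eq_mob k _ hζ, sub_mob_div (h.norm_param_lt_one k)
      (norm_lt_one_of_mul hζ (h.norm_lt_one _ _ hζ).le).le]
    exact mul_div_cancel_left₀ _ (Complex.exp_ne_zero _)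

lemma tendsto_schurIterate (h : IsSchurChain w F) (hℓ : 0 < ℓ)
    (hf : ∀ z : ℍ, f z = F 0 (nome ℓ z)) (k : ℕ) :
    Tendsto (alongImaginaryAxis (schurIterate ℓ f k)) atTop (𝓝 (w k)) := by
  rw [← h.apply_zero k]
  exact tendsto_alongImaginaryAxis hℓ (h.continuousAt_zero k) (h.schurIterate_eq hℓ hf k)

lemma recurrenceCoeff_eq (h : IsSchurChain w F) (hℓ : 0 < ℓ)
    (hf : ∀ z : ℍ, f z = F 0 (nome ℓ z)) (k : ℕ) : recurrenceCoeff ℓ f k = w k :=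
  (h.tendsto_schurIterate hℓ hf k).limUnder_eq

end IsSchurChain

lemma exists_isSchurChain_of_mem_periodicSchurClass (hf : f ∈ periodicSchurClass ℓ) :
    ∃ (w : ℕ → ℂ) (F : ℕ → ℂ → ℂ), IsSchurChain w F ∧ ∀ z : ℍ, f z = F 0 (nome ℓ z) := by
  obtain ⟨-, G, hG, hfG⟩ := hf
  obtain ⟨w, F, h, rfl⟩ := exists_isSchurChain hG
  exact ⟨w, F, h, hfG⟩

lemma eq_schurFunction_of_schurParam {q : LocalComplexMeasure} (hℓ : 0 < ℓ)
    (hq : q.SupportedOnLattice ℓ) (h : IsSchurChain w F) (hf : ∀ z : ℍ, f z = F 0 (nome ℓ z))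
    (hw : ∀ k : ℕ, q.atom (ℓ * k) = kappa (w k)) : schurFunction q = f := by
  funext z
  rw [schurFunction_eq hℓ hq, hf, h.eq_schurLimit (norm_nome_lt_one hℓ z)]
  congr 1
  funext k
  rw [hw, schurParam_kappa (h.norm_param_lt_one k)]

/-- The chain of Schur functions of a potential on the half-lattice. -/
lemma isSchurChain_atom (ℓ : ℝ) (q : LocalComplexMeasure) :
    IsSchurChain (fun k => schurParam (q.atom (ℓ * k)))
      fun k => schurLimit fun j => schurParam (q.atom (ℓ * (j + k : ℕ))) :=
  isSchurChain_schurLimit (norm_schurParam_atom_lt_one ℓ q)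

lemma atom_eq_kappa_recurrenceCoeff {q : LocalComplexMeasure} (hℓ : 0 < ℓ)
    (hq : q.SupportedOnLattice ℓ) (k : ℕ) :
    q.atom (ℓ * k) = kappa (recurrenceCoeff ℓ (schurFunction q) k) := by
  rw [(isSchurChain_atom ℓ q).recurrenceCoeff_eq hℓ (schurFunction_eq hℓ hq), kappa_schurParam]

end UpperHalfPlaneChain

end DiracSchur

/-! ### The direct and inverse theorems -/

theorem mainTheorem2 (ℓ : ℝ) (hℓ : 0 < ℓ) :
    -- direct problem
    (∀ q : DiracSchur.LocalComplexMeasure, q.SupportedOnLattice ℓ →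
      -- the fundamental solution, the Weyl function and the Schur function are well defined
      (∀ z : ℍ, (∃! N, DiracSchur.IsFundamentalSolution q z N) ∧
        Tendsto (fun x : ℝ => DiracSchur.fundamentalSolution q z x 1 1 /
          DiracSchur.fundamentalSolution q z x 1 0) atTop (𝓝 (DiracSchur.weylFunction q z)) ∧
        DiracSchur.weylFunction q z =
          Complex.I * (1 + DiracSchur.schurFunction q z) / (1 - DiracSchur.schurFunction q z)) ∧
      -- the Schur function is periodic and nondegenerate
      (∀ z : ℍ, DiracSchur.schurFunction q ((Real.pi / ℓ) +ᵥ z) = DiracSchur.schurFunction q z) ∧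
      DiracSchur.schurFunction q ∈ DiracSchur.periodicSchurClass ℓ ∧
      -- its recurrence coefficients are well defined and give the point masses of `q`
      (∀ k : ℕ,
        Tendsto (DiracSchur.alongImaginaryAxis
            (DiracSchur.schurIterate ℓ (DiracSchur.schurFunction q) k)) atTop
          (𝓝 (DiracSchur.recurrenceCoeff ℓ (DiracSchur.schurFunction q) k)) ∧
        ‖DiracSchur.recurrenceCoeff ℓ (DiracSchur.schurFunction q) k‖ < 1 ∧
        q.atom (ℓ * k) =
          DiracSchur.kappa (DiracSchur.recurrenceCoeff ℓ (DiracSchur.schurFunction q) k))) ∧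
    -- inverse problem: every element of the class arises from exactly one `q`
    (∀ f ∈ DiracSchur.periodicSchurClass ℓ,
      ∃! q : DiracSchur.LocalComplexMeasure,
        q.SupportedOnLattice ℓ ∧ DiracSchur.schurFunction q = f) ∧
    -- `q` and `f_q` determine each other through the recurrence coefficients
    (∀ q : DiracSchur.LocalComplexMeasure, q.SupportedOnLattice ℓ →
      ∀ f ∈ DiracSchur.periodicSchurClass ℓ,
        DiracSchur.schurFunction q = f ↔
          ∀ k : ℕ, q.atom (ℓ * k) = DiracSchur.kappa (DiracSchur.recurrenceCoeff ℓ f k)) := by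
  refine ⟨fun q hq => ⟨fun z => ⟨?_, ?_, ?_⟩, fun z => ?_, ⟨fun z => ?_, ?_⟩, fun k => ?_⟩,
    fun f hf => ?_, fun q hq f hf => ⟨?_, fun h => ?_⟩⟩
  · exact DiracSchur.existsUnique_isFundamentalSolution hℓ hq
  · rw [DiracSchur.weylFunction_eq hℓ hq]
    exact DiracSchur.tendsto_quotient hℓ hq z
  · rw [DiracSchur.schurFunction_eq hℓ hq, DiracSchur.weylFunction_eq hℓ hq]
  · rw [DiracSchur.schurFunction_eq hℓ hq, DiracSchur.schurFunction_eq hℓ hq]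
    congr 1
    have hℓ' : (ℓ : ℂ) ≠ 0 := by exact_mod_cast hℓ.ne'
    rw [DiracSchur.nome, DiracSchur.nome, UpperHalfPlane.coe_vadd]
    have e : 2 * Complex.I * (ℓ : ℂ) * (((Real.pi / ℓ : ℝ) : ℂ) + z) =
        2 * Complex.I * (ℓ : ℂ) * z + 2 * Real.pi * Complex.I := by
      push_cast
      field_simp
      ring
    rw [e, Complex.exp_periodic]
  · rw [DiracSchur.schurFunction_eq hℓ hq]
    exact DiracSchur.norm_schurLimit_lt_one (DiracSchur.norm_schurParam_atom_lt_one ℓ q)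
      (DiracSchur.norm_nome_lt_one hℓ z)
  · exact ⟨_, (DiracSchur.isSchurChain_atom ℓ q).mem_schurClassDisk,
      DiracSchur.schurFunction_eq hℓ hq⟩
  · have hc := DiracSchur.isSchurChain_atom ℓ q
    have hf := DiracSchur.schurFunction_eq hℓ hq
    refine ⟨?_, ?_, DiracSchur.atom_eq_kappa_recurrenceCoeff hℓ hq k⟩
    · rw [hc.recurrenceCoeff_eq hℓ hf]
      exact hc.tendsto_schurIterate hℓ hf k
    · rw [hc.recurrenceCoeff_eq hℓ hf]
      exact hc.norm_param_lt_one k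
  -- The Schur parameters of f prescribe the atoms ϰ(wₖ) of the potential; conversely, the atoms of
  -- any p with this Schur function are read off from its recurrence coefficients.
  · obtain ⟨w, F, hF, hfF⟩ := DiracSchur.exists_isSchurChain_of_mem_periodicSchurClass hf
    have hs := DiracSchur.LocalComplexMeasure.supportedOnLattice_ofAtoms hℓ
      fun k => DiracSchur.kappa (w k)
    have ha := DiracSchur.LocalComplexMeasure.atom_ofAtoms hℓ fun k => DiracSchur.kappa (w k)
    refine ⟨_, ⟨hs, DiracSchur.eq_schurFunction_of_schurParam hℓ hs hF hfF ha⟩, ?_⟩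
    rintro p ⟨hp, rfl⟩
    refine DiracSchur.LocalComplexMeasure.ext_of_atom hℓ hp hs fun k => ?_
    rw [DiracSchur.atom_eq_kappa_recurrenceCoeff hℓ hp, hF.recurrenceCoeff_eq hℓ hfF, ha]
  · rintro rfl
    exact DiracSchur.atom_eq_kappa_recurrenceCoeff hℓ hq
  · obtain ⟨w, F, hF, hfF⟩ := DiracSchur.exists_isSchurChain_of_mem_periodicSchurClass hf
    refine DiracSchur.eq_schurFunction_of_schurParam hℓ hq hF hfF fun k => ?_
    rw [h k, hF.recurrenceCoeff_eq hℓ hfF]
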